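/- **Setting.** Let $1\le M\le N$. There are users $1,\dots,M$ and channels $1,\dots,N$. A *channel block* is given by integers $(c,s,q)$ with $1\le c\le\lfloor N/M\rfloor$; $0\le s\le\lfloor (N-cM)/(c-1)\rfloor$ if $c\ge 2$, and $s=0$ if $c=1$; and $0\le q\le N-L$, where $L=(c-1)(M+s)+M$. In this block the user with order $v\in\{1,\dots,M\}$ gets the $c$ equidistant channels $J_v(c,s,q)=\{\,q+k(M+s)+v : 0\le k<c\,\}$. An *interleaved allocation* consists of a channel block $(c,s,q)$, a permutation $\nu$ of $\{1,\dots,M\}$ ($\nu_i$ is the order of user $i$), and a power $p_i$ that user $i$ uses on each one of its channels. An instance of *Min-Power* is given by rate functions $f(i,j,p)$ (user $i$, channel $j$, power $p$), demands $d_i$, a user power limit $P^u$ and a channel power limit $P^s$. The allocation is feasible if, for every user $i$, $p_i$ lies in $A_i(J)=\{p\ge 0 : \sum_{j\in J}f(i,j,p)\ge d_i,\ cp\le P^u,\ p\le P^s\}$ with $J=J_{\nu_i}(c,s,q)$. The task is to find a feasible allocation with the least total power $\sum_{i}\sum_{j\in J_{\nu_i}(c,s,q)}p_i$ over all channel blocks,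 permutations and powers. The rate functions are arbitrary, except that each set $A_i(J_v(c,s,q))$ is assumed to be empty or to have a least element (as is the case if $f(i,j,\cdot)$ is continuous). The model of computation is a random access machine with cells for natural numbers and for reals. Additions, subtractions, comparisons and memory accesses cost one step each. The rates, demands and limits are accessed only through a routine that, given a user $i$ and a list of $n$ channels forming a set $J$, returns $\min\{p\ge 0:\sum_{j\in J}f(i,j,p)\ge d_i,\ |J|p\le P^u,\ p\le P^s\}$ or reports that there is no such minimum; a call costs $O(n)$ steps. **Theorem.** For all $1\le M\le N$ there are at most $(N+1)+(N+1)^3=O(N^3)$ channel blocks. Min-Power for interleaved channel allocation has a polynomial-time algorithm for global optimality: there are one program and one constant $C$ such that for all $1\le M\le N$ and every instance with $M$ users and $N$ channels, the program, started with input $(M,N)$, halts after at most $C\,M^3N^3$ steps and returns a globally optimal allocation $(c,s,q,\nu,p)$ with its total power, or reports infeasibility if there is no feasible allocation. -/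

import Mathlib

/-! ## Interleaved channel allocation and the Min-Power problem

Users are `0, …, M - 1` and channels are `0, …, N - 1`. -/

namespace IFDMA

/-- Parameters of a channel block: `c` sub blocks of `M` consecutive channels each, `s` unused
channels between neighbouring sub blocks, and `q` unused channels before the first one. -/
structure Block where
  c : ℕ
  s : ℕ
  q : ℕ

/-- The number of channels from the first to the last channel of the block. -/
def Block.length (b : Block) (M : ℕ) : ℕ := (b.c - 1) * (M + b.s) + M

/-- The parameter ranges of the channel blocks for `M` users and `N` channels. If there is only
one sub block, then `s` is meaningless and is fixed to be `0`. -/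
def Block.IsValid (b : Block) (M N : ℕ) : Prop :=
  1 ≤ b.c ∧ b.c ≤ N / M ∧
  (b.c = 1 → b.s = 0) ∧
  (2 ≤ b.c → b.s ≤ (N - b.c * M) / (b.c - 1)) ∧
  b.q ≤ N - b.length M

/-- The channels of the user that has order `v` in every sub block. -/
def Block.channels (b : Block) (M N : ℕ) (v : Fin M) : Finset (Fin N) :=
  {j : Fin N | ∃ k < b.c, (j : ℕ) = b.q + k * (M + b.s) + v}

/-- An instance of Min-Power. `rate i j p` is the rate of user `i` on channel `j` with power `p`. -/
structure Instance (M N : ℕ) where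
  rate : Fin M → Fin N → ℝ → ℝ
  demand : Fin M → ℝ
  userLimit : ℝ
  channelLimit : ℝ

namespace Instance

variable {M N : ℕ}

/-- The powers `p` such that user `i`, using power `p` on each channel of `J`, meets its demand
and respects both power limits. -/
def admissible (I : Instance M N) (i : Fin M) (J : Finset (Fin N)) : Set ℝ :=
  {p | 0 ≤ p ∧ I.demand i ≤ ∑ j ∈ J, I.rate i j p ∧
    (J.card : ℝ) * p ≤ I.userLimit ∧ p ≤ I.channelLimit}

/-- The minimum power of a user is well defined wherever the demand of the user can be met. -/
def HasMinima (I : Instance M N) : Prop :=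
  ∀ b : Block, b.IsValid M N → ∀ i v : Fin M,
    (I.admissible i (b.channels M N v)).Nonempty →
      ∃ p, IsLeast (I.admissible i (b.channels M N v)) p

end Instance

/-- A channel block, the order of each user in every sub block, and the power that each user has
on each one of its channels. -/
structure Allocation (M : ℕ) where
  block : Block
  order : Equiv.Perm (Fin M)
  power : Fin M → ℝ

/-- The total power: the sum over all users and over all channels of the user. -/
def Allocation.totalPower {M : ℕ} (a : Allocation M) (N : ℕ) : ℝ :=
  ∑ i : Fin M, ∑ _j ∈ a.block.channels M N (a.order i), a.power i

namespace Instance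

variable {M N : ℕ}

def IsFeasible (I : Instance M N) (a : Allocation M) : Prop :=
  a.block.IsValid M N ∧
  ∀ i : Fin M, a.power i ∈ I.admissible i (a.block.channels M N (a.order i))

/-- Global optimality, over all channel blocks, all orders of the users and all powers. -/
def IsOptimal (I : Instance M N) (a : Allocation M) : Prop :=
  I.IsFeasible a ∧ ∀ a' : Allocation M, I.IsFeasible a' → a.totalPower N ≤ a'.totalPower N

open Classical in
/-- The least power with which user `i` meets its demand on the channels in `S` within the power
limits, or `none` if there is no such power. -/
noncomputable def minPower (I : Instance M N) (i : ℕ) (S : Finset ℕ) : Option ℝ :=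
  if h : ∃ (hi : i < M) (p : ℝ),
      IsLeast (I.admissible ⟨i, hi⟩ {j : Fin N | (j : ℕ) ∈ S}) p
  then some h.choose_spec.choose else none

end Instance

end IFDMA

/-! ## Random access machine programs

The memory consists of arrays of natural numbers and arrays of reals; a program names finitely many
of them, and cells are addressed by computed indices. The only operations are addition, subtraction
and comparison (there is no multiplication, no rounding of reals, and no real constant but `0`), and
calls of the routine that finds the minimum power of one user on one list of channels. -/

namespace RAM

/-- `nat a k` and `real a k` are the cells `k` of the arrays `a`. -/
structure State where
  nat : ℕ → ℕ → ℕ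
  real : ℕ → ℕ → ℝ

/-- Write into one cell of an array. -/
def write {α : Type} (m : ℕ → ℕ → α) (a k : ℕ) (x : α) : ℕ → ℕ → α :=
  Function.update m a (Function.update (m a) k x)

/-- Expressions with values in the natural numbers; `sub` is truncated. -/
inductive NatExp where
  | const (n : ℕ)
  | read (a : ℕ) (k : NatExp)
  | add (x y : NatExp)
  | sub (x y : NatExp)

def NatExp.eval (σ : State) : NatExp → ℕ
  | const n => n
  | read a k => σ.nat a (k.eval σ)
  | add x y => x.eval σ + y.eval σ
  | sub x y => x.eval σ - y.eval σ

/-- The cost of an evaluation is the size of the expression. -/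
def NatExp.cost : NatExp → ℕ
  | const _ => 1
  | read _ k => k.cost + 1
  | add x y => x.cost + y.cost + 1
  | sub x y => x.cost + y.cost + 1

inductive RealExp where
  | zero
  | read (a : ℕ) (k : NatExp)
  | add (x y : RealExp)
  | sub (x y : RealExp)

noncomputable def RealExp.eval (σ : State) : RealExp → ℝ
  | zero => 0
  | read a k => σ.real a (k.eval σ)
  | add x y => x.eval σ + y.eval σ
  | sub x y => x.eval σ - y.eval σ

def RealExp.cost : RealExp → ℕ
  | zero => 1
  | read _ k => k.cost + 1
  | add x y => x.cost + y.cost + 1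
  | sub x y => x.cost + y.cost + 1

inductive Test where
  | natLe (x y : NatExp)
  | realLe (x y : RealExp)
  | neg (b : Test)
  | conj (b b' : Test)

def Test.Holds (σ : State) : Test → Prop
  | natLe x y => x.eval σ ≤ y.eval σ
  | realLe x y => x.eval σ ≤ y.eval σ
  | neg b => ¬ b.Holds σ
  | conj b b' => b.Holds σ ∧ b'.Holds σ

def Test.cost : Test → ℕ
  | natLe x y => x.cost + y.cost + 1
  | realLe x y => x.cost + y.cost + 1
  | neg b => b.cost + 1
  | conj b b' => b.cost + b'.cost + 1

inductive Program where
  | skip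
  /-- Write the value of `x` into the cell `k` of the array `a` of natural numbers. -/
  | setNat (a : ℕ) (k x : NatExp)
  /-- Write the value of `x` into the cell `k` of the array `a` of reals. -/
  | setReal (a : ℕ) (k : NatExp) (x : RealExp)
  | seq (P Q : Program)
  | branch (b : Test) (P Q : Program)
  | loop (b : Test) (P : Program)
  /-- Find the minimum power of user `i` on the channels that are listed in the first `n` cells of
  the array `a`. Whether there is one (`1` or `0`) is written into the cell `0` of the array `r` of
  natural numbers, and the power (or `0`) into the cell `0` of the array `r` of reals. -/
  | call (i : NatExp) (a : ℕ) (n : NatExp) (r : ℕ)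

/-- The channels listed in the first `n` cells of the array `a`. -/
def State.listed (σ : State) (a n : ℕ) : Finset ℕ := (Finset.range n).image (σ.nat a)

/-- The memory after a call with the given answer. -/
noncomputable def State.answer (σ : State) (r : ℕ) (o : Option ℝ) : State :=
  ⟨write σ.nat r 0 (if o.isSome then 1 else 0), write σ.real r 0 (o.getD 0)⟩

/-- `Exec O P σ τ t`: the program `P`, started in the state `σ`, halts in the state `τ` after `t`
steps, where calls are answered by `O`. Each command and each node of an expression costs one step;
a call costs one more step for each channel of the list. -/
inductive Exec (O : ℕ → Finset ℕ → Option ℝ) : Program → State → State → ℕ → Prop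
  | skip (σ : State) : Exec O .skip σ σ 1
  | setNat (σ : State) (a : ℕ) (k x : NatExp) :
      Exec O (.setNat a k x) σ ⟨write σ.nat a (k.eval σ) (x.eval σ), σ.real⟩
        (k.cost + x.cost + 1)
  | setReal (σ : State) (a : ℕ) (k : NatExp) (x : RealExp) :
      Exec O (.setReal a k x) σ ⟨σ.nat, write σ.real a (k.eval σ) (x.eval σ)⟩
        (k.cost + x.cost + 1)
  | seq {P Q : Program} {σ σ' τ : State} {t t' : ℕ} :
      Exec O P σ σ' t → Exec O Q σ' τ t' → Exec O (.seq P Q) σ τ (t + t' + 1)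
  | branchTrue {b : Test} {P Q : Program} {σ τ : State} {t : ℕ} :
      b.Holds σ → Exec O P σ τ t → Exec O (.branch b P Q) σ τ (b.cost + t + 1)
  | branchFalse {b : Test} {P Q : Program} {σ τ : State} {t : ℕ} :
      ¬ b.Holds σ → Exec O Q σ τ t → Exec O (.branch b P Q) σ τ (b.cost + t + 1)
  | loopStop {b : Test} {P : Program} {σ : State} :
      ¬ b.Holds σ → Exec O (.loop b P) σ σ (b.cost + 1)
  | loopStep {b : Test} {P : Program} {σ σ' τ : State} {t t' : ℕ} :
      b.Holds σ → Exec O P σ σ' t → Exec O (.loop b P) σ' τ t' →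
      Exec O (.loop b P) σ τ (b.cost + t + t' + 1)
  | call (σ : State) (i : NatExp) (a : ℕ) (n : NatExp) (r : ℕ) :
      Exec O (.call i a n r) σ (σ.answer r (O (i.eval σ) (σ.listed a (n.eval σ))))
        (i.cost + n.cost + n.eval σ + 1)

/-- The input: `M` and `N` in the cells `0` and `1` of the array `0`, all other cells `0`. -/
def State.init (M N : ℕ) : State :=
  ⟨write (write (fun _ _ => 0) 0 0 M) 0 1 N, fun _ _ => 0⟩

/-- The final memory says that there is no feasible allocation. -/
def State.ReportsInfeasible (σ : State) : Prop := σ.nat 1 0 = 0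

/-- The final memory holds the allocation `a` and its total power. -/
def State.Returns (σ : State) {M : ℕ} (a : IFDMA.Allocation M) (N : ℕ) : Prop :=
  σ.nat 1 0 = 1 ∧ σ.nat 1 1 = a.block.c ∧ σ.nat 1 2 = a.block.s ∧ σ.nat 1 3 = a.block.q ∧
  (∀ i : Fin M, σ.nat 2 i = a.order i) ∧
  (∀ i : Fin M, σ.real 0 i = a.power i) ∧
  σ.real 1 0 = a.totalPower N

end RAM

/-! ## A program logic for random access machine programs -/

namespace RAM

/-! Fix a channel block. Every user then holds exactly `c` channels at one power, so the total power
is `c` times the sum of the users' powers, and the users interact only through the requirement that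
their orders form a permutation. The least power of user `i` at order `v` is one answer of the
routine. A block is therefore a linear assignment problem on an `M × M` matrix with forbidden
entries (`exists_assignment`, `exists_allocation`), and the blocks are enumerated.

The assignment problem is solved by the Hungarian method. Potentials with nonnegative reduced costs
bound every perfect matching from below, with equality for a matching of tight entries
(`TightMatching.sum_le`). To insert a row, sets of visited rows and columns are grown. The
potentials are shifted by the least reduced cost between a visited row and an unvisited column; this
keeps the reduced costs nonnegative and the matched entries tight, and makes a new entry tight
(`Search.step`, `Search.finish`). If no such entry exists, the visited rows violate Hall's condition
(`Search.not_exists_matching`). Instead of predecessor pointers, a whole matching is stored for each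
visited row, so augmenting means copying one matching and changing one entry.

A search step costs O(M²), an insertion O(M³), an assignment O(M⁴), and the matrix of a block
O(M²c). Multiplying by the N³ bound on the number of blocks would be too coarse. For fixed `c ≥ 2`
there are at most `N / (c - 1) + 1` gaps (one gap if `c = 1`) and `N` offsets; the number of gaps is
O(N) even after multiplication by `c`, so each `c` costs O(N²M⁴). Only `N / M` values of `c` occur,
which gives O(M³N³). -/

/-- `P`, started in `σ`, halts after `t` steps in a state `τ` such that `R τ t`. -/
def Wp (O : ℕ → Finset ℕ → Option ℝ) (P : Program) (σ : State) (R : State → ℕ → Prop) : Prop :=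
  ∃ τ t, Exec O P σ τ t ∧ R τ t

theorem write_self {α : Type} (m : ℕ → ℕ → α) (a k : ℕ) (x : α) (k' : ℕ) :
    write m a k x a k' = if k' = k then x else m a k' := by
  simp [write, Function.update_apply]

theorem write_of_ne {α : Type} (m : ℕ → ℕ → α) {a a' : ℕ} (k : ℕ) (x : α) (h : a' ≠ a) :
    write m a k x a' = m a' := by
  simp [write, h]

attribute [simp] write_self write_of_ne NatExp.eval NatExp.cost RealExp.eval RealExp.cost
  Test.Holds Test.cost

section

variable {O : ℕ → Finset ℕ → Option ℝ} {σ : State} {R R' : State → ℕ → Prop}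

theorem Wp.mono {P : Program} (h : Wp O P σ R) (hR : ∀ τ t, R τ t → R' τ t) : Wp O P σ R' := by
  obtain ⟨τ, t, h, hr⟩ := h
  exact ⟨τ, t, h, hR τ t hr⟩

/-- Inversion of `Exec` makes the rules for all commands except loops equivalences, so that
loop-free code is executed by rewriting. -/
theorem wp_skip : Wp O .skip σ R ↔ R σ 1 :=
  ⟨fun ⟨_, _, h, hR⟩ => by cases h; exact hR, fun h => ⟨_, _, .skip σ, h⟩⟩

theorem wp_setNat {a : ℕ} {k x : NatExp} : Wp O (.setNat a k x) σ R ↔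
    R ⟨write σ.nat a (k.eval σ) (x.eval σ), σ.real⟩ (k.cost + x.cost + 1) :=
  ⟨fun ⟨_, _, h, hR⟩ => by cases h; exact hR, fun h => ⟨_, _, .setNat σ a k x, h⟩⟩

theorem wp_setReal {a : ℕ} {k : NatExp} {x : RealExp} : Wp O (.setReal a k x) σ R ↔
    R ⟨σ.nat, write σ.real a (k.eval σ) (x.eval σ)⟩ (k.cost + x.cost + 1) :=
  ⟨fun ⟨_, _, h, hR⟩ => by cases h; exact hR, fun h => ⟨_, _, .setReal σ a k x, h⟩⟩

theorem wp_call {i : NatExp} {a : ℕ} {n : NatExp} {r : ℕ} : Wp O (.call i a n r) σ R ↔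
    R (σ.answer r (O (i.eval σ) (σ.listed a (n.eval σ)))) (i.cost + n.cost + n.eval σ + 1) :=
  ⟨fun ⟨_, _, h, hR⟩ => by cases h; exact hR, fun h => ⟨_, _, .call σ i a n r, h⟩⟩

theorem wp_seq {P Q : Program} : Wp O (.seq P Q) σ R ↔
    Wp O P σ fun σ' t => Wp O Q σ' fun τ t' => R τ (t + t' + 1) := by
  constructor
  · rintro ⟨τ, t, h, hR⟩
    cases h with
    | seq h h' => exact ⟨_, _, h, _, _, h', hR⟩
  · rintro ⟨σ', t, h, τ, t', h', hR⟩
    exact ⟨_, _, .seq h h', hR⟩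

theorem wp_branch {b : Test} {P Q : Program} : Wp O (.branch b P Q) σ R ↔
    (b.Holds σ → Wp O P σ fun τ t => R τ (b.cost + t + 1)) ∧
    (¬ b.Holds σ → Wp O Q σ fun τ t => R τ (b.cost + t + 1)) := by
  constructor
  · rintro ⟨τ, t, h, hR⟩
    cases h with
    | branchTrue hb h => exact ⟨fun _ => ⟨_, _, h, hR⟩, fun hn => absurd hb hn⟩
    | branchFalse hb h => exact ⟨fun hn => absurd hn hb, fun _ => ⟨_, _, h, hR⟩⟩
  · rintro ⟨h1, h2⟩
    by_cases hb : b.Holds σ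
    · obtain ⟨τ, t, h, hR⟩ := h1 hb
      exact ⟨_, _, .branchTrue hb h, hR⟩
    · obtain ⟨τ, t, h, hR⟩ := h2 hb
      exact ⟨_, _, .branchFalse hb h, hR⟩

/-- The arrays of natural numbers that a program may write to. -/
def Program.natTargets : Program → List ℕ
  | .skip => []
  | .setNat a _ _ => [a]
  | .setReal _ _ _ => []
  | .seq P Q => P.natTargets ++ Q.natTargets
  | .branch _ P Q => P.natTargets ++ Q.natTargets
  | .loop _ P => P.natTargets
  | .call _ _ _ r => [r]

/-- The arrays of reals that a program may write to. -/
def Program.realTargets : Program → List ℕ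
  | .skip => []
  | .setNat _ _ _ => []
  | .setReal a _ _ => [a]
  | .seq P Q => P.realTargets ++ Q.realTargets
  | .branch _ P Q => P.realTargets ++ Q.realTargets
  | .loop _ P => P.realTargets
  | .call _ _ _ r => [r]

/-- The states agree on all arrays that `P` does not write to. -/
structure Agree (P : Program) (σ τ : State) : Prop where
  nat : ∀ a ∉ P.natTargets, τ.nat a = σ.nat a
  real : ∀ a ∉ P.realTargets, τ.real a = σ.real a

theorem Agree.refl (P : Program) (σ : State) : Agree P σ σ := ⟨fun _ _ => rfl, fun _ _ => rfl⟩

theorem Agree.trans {P : Program} {σ σ' τ : State} (h : Agree P σ σ') (h' : Agree P σ' τ) :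
    Agree P σ τ :=
  ⟨fun a ha => (h'.nat a ha).trans (h.nat a ha), fun a ha => (h'.real a ha).trans (h.real a ha)⟩

theorem Agree.of_subset {P Q : Program} {τ : State} (h : Agree P σ τ)
    (hn : P.natTargets ⊆ Q.natTargets) (hr : P.realTargets ⊆ Q.realTargets) : Agree Q σ τ :=
  ⟨fun a ha => h.nat a fun h' => ha (hn h'), fun a ha => h.real a fun h' => ha (hr h')⟩

/-- The frame rule. Its footprint is syntactic, so for concrete programs the side conditions are
settled by `decide`. -/
theorem Exec.agree {P : Program} {τ : State} {t : ℕ} (h : Exec O P σ τ t) : Agree P σ τ := by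
  induction h with
  | skip => exact .refl _ _
  | setNat σ a k x =>
    exact ⟨fun b hb => write_of_ne _ _ _ (by simpa [Program.natTargets] using hb), fun _ _ => rfl⟩
  | setReal σ a k x =>
    exact ⟨fun _ _ => rfl, fun b hb => write_of_ne _ _ _ (by simpa [Program.realTargets] using hb)⟩
  | seq _ _ ih ih' =>
    exact (ih.of_subset (by simp [Program.natTargets]) (by simp [Program.realTargets])).trans
      (ih'.of_subset (by simp [Program.natTargets]) (by simp [Program.realTargets]))
  | branchTrue _ _ ih =>
    exact ih.of_subset (by simp [Program.natTargets]) (by simp [Program.realTargets])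
  | branchFalse _ _ ih =>
    exact ih.of_subset (by simp [Program.natTargets]) (by simp [Program.realTargets])
  | loopStop => exact .refl _ _
  | loopStep _ _ _ ih ih' => exact Agree.trans ⟨ih.nat, ih.real⟩ ih'
  | call σ i a n r =>
    exact ⟨fun b hb => write_of_ne _ _ _ (by simpa [Program.natTargets] using hb),
      fun b hb => write_of_ne _ _ _ (by simpa [Program.realTargets] using hb)⟩

theorem Wp.agree {P : Program} (h : Wp O P σ R) : Wp O P σ fun τ t => R τ t ∧ Agree P σ τ := by
  obtain ⟨τ, t, h, hr⟩ := h
  exact ⟨τ, t, h, hr, h.agree⟩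

/-- A loop with an invariant `Inv` and a bound `Φ` for the remaining time. -/
theorem wp_loop {b : Test} {P : Program} (Inv : State → Prop) (Φ : State → ℕ) (h0 : Inv σ)
    (hstep : ∀ σ', Agree P σ σ' → Inv σ' → b.Holds σ' →
      Wp O P σ' fun τ t => Inv τ ∧ b.cost + t + 1 + Φ τ ≤ Φ σ')
    (hexit : ∀ σ', Agree P σ σ' → Inv σ' → ¬ b.Holds σ' → b.cost + 1 ≤ Φ σ') :
    Wp O (.loop b P) σ fun τ t => Inv τ ∧ ¬ b.Holds τ ∧ t ≤ Φ σ ∧ Agree P σ τ := by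
  suffices H : ∀ n, ∀ σ', Φ σ' = n → Agree P σ σ' → Inv σ' →
      Wp O (.loop b P) σ' fun τ t => Inv τ ∧ ¬ b.Holds τ ∧ t ≤ Φ σ' ∧ Agree P σ τ from
    H _ σ rfl (.refl _ _) h0
  intro n
  induction n using Nat.strong_induction_on with
  | _ n ih =>
    intro σ' hn ha hi
    by_cases hb : b.Holds σ'
    · obtain ⟨σ₁, t₁, h₁, hi₁, ht₁⟩ := hstep σ' ha hi hb
      -- Each pass costs at least one step, so the time bound `Φ` strictly decreases and also proves
      -- termination.
      obtain ⟨τ, t, h, hτ, hbτ, ht, haτ⟩ := ih (Φ σ₁) (by omega) σ₁ rfl (ha.trans h₁.agree) hi₁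
      exact ⟨τ, _, .loopStep hb h₁ h, hτ, hbτ, by omega, haτ⟩
    · exact ⟨σ', _, .loopStop hb, hi, hb, hexit σ' ha hi hb, ha⟩

/-- A loop in which each pass takes at most `T` steps and decreases the variant `m`. -/
theorem wp_loop_variant {b : Test} {P : Program} (Inv : State → Prop) (m : State → ℕ) (T : ℕ)
    (h0 : Inv σ)
    (hstep : ∀ σ', Agree P σ σ' → Inv σ' → b.Holds σ' →
      Wp O P σ' fun τ t => Inv τ ∧ m τ < m σ' ∧ t ≤ T) :
    Wp O (.loop b P) σ fun τ t => Inv τ ∧ ¬ b.Holds τ ∧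
      t ≤ m σ * (T + b.cost + 1) + (b.cost + 1) ∧ Agree P σ τ := by
  refine wp_loop Inv (fun σ => m σ * (T + b.cost + 1) + (b.cost + 1)) h0 ?_ ?_
  · intro σ' ha hi hb
    refine (hstep σ' ha hi hb).mono fun τ t ⟨h1, h2, h3⟩ => ⟨h1, ?_⟩
    have : (m τ + 1) * (T + b.cost + 1) ≤ m σ' * (T + b.cost + 1) := Nat.mul_le_mul_right _ h2
    rw [Nat.add_mul] at this
    omega
  · intros; omega

end

/-- The value of the cell `0` of an array of natural numbers. -/
abbrev NatExp.get (a : ℕ) : NatExp := .read a (.const 0)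

/-- Write into the cell `0` of an array of natural numbers. -/
abbrev Program.put (a : ℕ) (x : NatExp) : Program := .setNat a (.const 0) x

abbrev Test.lt (x y : NatExp) : Test := .neg (.natLe y x)

/-- Flags are natural numbers; a positive one is set. -/
abbrev Test.set (x : NatExp) : Test := .natLe (.const 1) x

abbrev State.put (σ : State) (a x : ℕ) : State := ⟨write σ.nat a 0 x, σ.real⟩

/-- Run `P` with the values `0, …, n - 1` in the cell `0` of the array `x`. -/
def Program.forLoop (x : ℕ) (n : NatExp) (P : Program) : Program :=
  .seq (.put x (.const 0))
    (.loop (.lt (.get x) n) (.seq P (.put x (.add (.get x) (.const 1)))))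

/-- The invariant is required after the counter has been advanced, so it may mention the counter's
array. In the time bound, a pass adds to `T` the test, the increment and the loop overhead, `n.cost
+ 12` in all. -/
theorem wp_forLoop {O : ℕ → Finset ℕ → Option ℝ} {σ : State} {x : ℕ} {n : NatExp} {P : Program}
    (m T : ℕ) (Inv : ℕ → State → Prop) (hx : x ∉ P.natTargets)
    (hn : ∀ σ', Agree (.forLoop x n P) σ σ' → n.eval σ' = m)
    (h0 : Inv 0 (σ.put x 0))
    (hstep : ∀ k < m, ∀ σ', Agree (.forLoop x n P) σ σ' → σ'.nat x 0 = k → Inv k σ' →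
      Wp O P σ' fun τ t => Inv (k + 1) (τ.put x (k + 1)) ∧ t ≤ T) :
    Wp O (.forLoop x n P) σ fun τ t => Inv m τ ∧ t ≤ m * (T + n.cost + 12) + (n.cost + 9) ∧
      Agree (.forLoop x n P) σ τ := by
  have h0a : Agree (.forLoop x n P) σ (σ.put x 0) :=
    ⟨fun a ha => write_of_ne _ _ _ fun h => ha (by simp [Program.forLoop, Program.natTargets, h]),
      fun _ _ => rfl⟩
  have hsub : ∀ {σ'}, Agree (.seq P (.put x (.add (.get x) (.const 1)))) (σ.put x 0) σ' →
      Agree (.forLoop x n P) σ σ' := fun h =>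
    h0a.trans (h.of_subset (by simp [Program.forLoop, Program.natTargets])
      (by simp [Program.forLoop, Program.realTargets]))
  rw [Program.forLoop, wp_seq, wp_setNat]
  refine (wp_loop_variant (σ := σ.put x 0) (fun σ' => Inv (σ'.nat x 0) σ' ∧ σ'.nat x 0 ≤ m)
    (fun σ' => m - σ'.nat x 0) (T + 7) (by simpa using h0) ?_).mono ?_
  · rintro σ' ha ⟨hi, -⟩ hb
    have hk : σ'.nat x 0 < m := by simpa [hn σ' (hsub ha)] using hb
    rw [wp_seq]
    refine (hstep _ hk σ' (hsub ha) rfl hi).agree.mono fun τ t ⟨⟨h, ht⟩, hP⟩ => ?_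
    have := congrFun (hP.nat x hx) 0
    rw [wp_setNat]
    simp only [NatExp.eval, this, NatExp.cost, write_self, if_true]
    exact ⟨⟨h, by omega⟩, by omega, by omega⟩
  · rintro τ t ⟨⟨hi, hle⟩, hb, ht, ha⟩
    have hk : m ≤ τ.nat x 0 := by simpa [hn τ (hsub ha)] using hb
    have hm : τ.nat x 0 = m := le_antisymm hle hk
    rw [hm] at hi
    refine ⟨hi, ?_, hsub ha⟩
    simp only [write_self, if_true, NatExp.cost, Test.cost, Nat.sub_zero] at ht ⊢
    ring_nf at ht ⊢
    omega

end RAM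

/-! ## The Hungarian method

Rows and columns are `0, …, M - 1`, the admissible entries of the cost matrix `W` are given by `F`,
and `U`, `V` are potentials of the rows and columns. Rows are inserted one after the other. The
search that inserts the row `cur` keeps, for each visited row `r`, a matching `A r` of tight entries
that covers all rows up to `cur` except `r`. -/

namespace Assignment

/-- Every reduced cost is nonnegative. -/
def IsDual (M : ℕ) (F : ℕ → ℕ → Prop) (W : ℕ → ℕ → ℝ) (U V : ℕ → ℝ) : Prop :=
  ∀ i < M, ∀ j < M, F i j → U i + V j ≤ W i j

/-- `μ` matches the rows in `S` to columns along admissible entries of reduced cost `0`. -/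
structure TightMatching (M : ℕ) (F : ℕ → ℕ → Prop) (W : ℕ → ℕ → ℝ) (U V : ℕ → ℝ) (S : Set ℕ)
    (μ : ℕ → ℕ) : Prop where
  lt : ∀ x ∈ S, μ x < M
  edge : ∀ x ∈ S, F x (μ x)
  tight : ∀ x ∈ S, U x + V (μ x) = W x (μ x)
  inj : Set.InjOn μ S

/-- The search for the row `cur` has visited the rows in `R` and the columns in `C`. -/
structure Search (M : ℕ) (F : ℕ → ℕ → Prop) (W : ℕ → ℕ → ℝ) (U V : ℕ → ℝ) (cur : ℕ) (R C : Set ℕ)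
    (A : ℕ → ℕ → ℕ) : Prop where
  cur_lt : cur < M
  dual : IsDual M F W U V
  row_le : ∀ x ∈ R, x ≤ cur
  root : cur ∈ R
  matching : ∀ r ∈ R, TightMatching M F W U V {x | x ≤ cur ∧ x ≠ r} (A r)
  -- Matched entries never join a visited and an unvisited side; this is why a shift of the
  -- potentials leaves every stored matching tight.
  col_iff : ∀ r ∈ R, ∀ x ≤ cur, x ≠ r → (A r x ∈ C ↔ x ∈ R)
  -- Because of this, the owner of an unvisited column can be looked up in `A cur` alone.
  unvisited : ∀ r ∈ R, ∀ x ≤ cur, x ∉ R → A r x = A cur x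
  col : ∀ j ∈ C, ∃ x ∈ R, x ≠ cur ∧ A cur x = j

variable {M : ℕ} {F : ℕ → ℕ → Prop} {W : ℕ → ℕ → ℝ} {U V U' V' : ℕ → ℝ} {cur : ℕ} {R C : Set ℕ}
  {A A' : ℕ → ℕ → ℕ}

theorem TightMatching.congr {S : Set ℕ} {μ ν : ℕ → ℕ} (h : TightMatching M F W U V S μ)
    (hν : ∀ x ∈ S, ν x = μ x) : TightMatching M F W U V S ν where
  lt x hx := by rw [hν x hx]; exact h.lt x hx
  edge x hx := by rw [hν x hx]; exact h.edge x hx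
  tight x hx := by rw [hν x hx]; exact h.tight x hx
  inj x hx y hy hxy := h.inj hx hy (by rwa [hν x hx, hν y hy] at hxy)

/-- Linear programming duality: the potentials add up to the same value along every perfect
matching, and this value is the cost of a tight one and a lower bound for all others. -/
theorem TightMatching.sum_le {μ ν : ℕ → ℕ} (h : TightMatching M F W U V {x | x < M} μ)
    (hd : IsDual M F W U V) (hlt : ∀ x < M, ν x < M) (hF : ∀ x < M, F x (ν x))
    (hinj : Set.InjOn ν {x | x < M}) :
    ∑ x ∈ Finset.range M, W x (μ x) ≤ ∑ x ∈ Finset.range M, W x (ν x) := by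
  -- An injective self-map of a finite set permutes it.
  have key : ∀ ρ : ℕ → ℕ, (∀ x < M, ρ x < M) → Set.InjOn ρ {x | x < M} →
      ∑ x ∈ Finset.range M, V (ρ x) = ∑ x ∈ Finset.range M, V x := by
    intro ρ h1 h2
    have h2' : Set.InjOn ρ (Finset.range M) := by simpa [Set.InjOn] using h2
    rw [← Finset.sum_image h2']
    congr 1
    apply Finset.eq_of_subset_of_card_le
    · intro y hy
      obtain ⟨x, hx, rfl⟩ := Finset.mem_image.1 hy
      exact Finset.mem_range.2 (h1 x (Finset.mem_range.1 hx))
    · rw [Finset.card_image_of_injOn h2']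
  calc ∑ x ∈ Finset.range M, W x (μ x) = ∑ x ∈ Finset.range M, (U x + V (μ x)) :=
        Finset.sum_congr rfl fun x hx => (h.tight x (Finset.mem_range.1 hx)).symm
    _ = ∑ x ∈ Finset.range M, (U x + V (ν x)) := by
        rw [Finset.sum_add_distrib, Finset.sum_add_distrib, key μ h.lt h.inj, key ν hlt hinj]
    _ ≤ ∑ x ∈ Finset.range M, W x (ν x) := Finset.sum_le_sum fun x hx =>
        have hx := Finset.mem_range.1 hx
        hd x hx _ (hlt x hx) (hF x hx)

theorem Search.start (hcur : cur < M) (hd : IsDual M F W U V)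
    (h : TightMatching M F W U V {x | x < cur} (A cur)) :
    Search M F W U V cur {cur} ∅ A where
  cur_lt := hcur
  dual := hd
  row_le x hx := hx.le
  root := rfl
  matching r hr := by
    obtain rfl : r = cur := hr
    have : {x | x ≤ r ∧ x ≠ r} = {x | x < r} := by ext x; exact lt_iff_le_and_ne.symm
    rwa [this]
  col_iff r hr x _ hxr := by
    obtain rfl : r = cur := hr
    simp [hxr]
  unvisited r hr x _ _ := by
    obtain rfl : r = cur := hr
    rfl
  col j hj := hj.elim

/-- If all admissible entries of the visited rows are in visited columns, then there is no perfect
matching. -/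
theorem Search.not_exists_matching (h : Search M F W U V cur R C A)
    (hF : ∀ i ∈ R, ∀ j < M, j ∉ C → ¬ F i j) (ν : ℕ → ℕ) (hlt : ∀ x < M, ν x < M)
    (hν : ∀ x < M, F x (ν x)) (hinj : Set.InjOn ν {x | x < M}) : False := by
  have hfin : R.Finite := (Set.finite_Iic cur).subset h.row_le
  have hRlt : ∀ x ∈ R, x < M := fun x hx => (h.row_le x hx).trans_lt h.cur_lt
  -- Hall's condition fails: `ν` would inject `R` into the visited columns, which are at most as
  -- many as the rows of `R` other than `cur`.
  have h1 : ν '' R ⊆ A cur '' (R \ {cur}) := by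
    rintro _ ⟨x, hx, rfl⟩
    have hC : ν x ∈ C := by
      by_contra hc
      exact hF x hx _ (hlt x (hRlt x hx)) hc (hν x (hRlt x hx))
    obtain ⟨y, hy, hne, hyx⟩ := h.col _ hC
    exact ⟨y, ⟨hy, hne⟩, hyx⟩
  have h2 := Set.ncard_le_ncard h1 ((hfin.sdiff).image _)
  rw [(hinj.mono hRlt).ncard_image] at h2
  have h3 := h2.trans (Set.ncard_image_le hfin.sdiff)
  have h4 := Set.ncard_sdiff_singleton_lt_of_mem h.root hfin
  omega

section Step

variable {r j : ℕ} {δ : ℝ}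

/-- The reduced cost drops only between visited rows and unvisited columns, by `δ`, which is at most
each of these reduced costs. Between unvisited rows and visited columns it grows, as `δ ≥ 0`;
elsewhere it is unchanged. -/
theorem Search.dual_update (h : Search M F W U V cur R C A) (hr : r ∈ R) (hj : j < M)
    (hrj : F r j) (hδ : δ = W r j - U r - V j)
    (hmin : ∀ i ∈ R, ∀ k < M, k ∉ C → F i k → δ ≤ W i k - U i - V k)
    (hU : ∀ x < M, (x ∈ R → U' x = U x + δ) ∧ (x ∉ R → U' x = U x))
    (hV : ∀ x < M, (x ∈ C → V' x = V x - δ) ∧ (x ∉ C → V' x = V x)) :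
    IsDual M F W U' V' := by
  intro i hi k hk hF
  have h0 : 0 ≤ δ := by
    have := h.dual r ((h.row_le r hr).trans_lt h.cur_lt) j hj hrj
    linarith
  have := h.dual i hi k hk hF
  by_cases hiR : i ∈ R <;> by_cases hkC : k ∈ C
  · rw [(hU i hi).1 hiR, (hV k hk).1 hkC]; linarith
  · rw [(hU i hi).1 hiR, (hV k hk).2 hkC]; linarith [hmin i hiR k hk hkC hF]
  · rw [(hU i hi).2 hiR, (hV k hk).1 hkC]; linarith
  · rw [(hU i hi).2 hiR, (hV k hk).2 hkC]; linarith

/-- By `col_iff` the ends of a matched entry are both visited or both unvisited, so the two shifts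
cancel or are both absent. The value of `δ` is irrelevant. -/
theorem Search.matching_update (h : Search M F W U V cur R C A) (hr : r ∈ R)
    (hU : ∀ x < M, (x ∈ R → U' x = U x + δ) ∧ (x ∉ R → U' x = U x))
    (hV : ∀ x < M, (x ∈ C → V' x = V x - δ) ∧ (x ∉ C → V' x = V x)) :
    TightMatching M F W U' V' {x | x ≤ cur ∧ x ≠ r} (A r) where
  lt := (h.matching r hr).lt
  edge := (h.matching r hr).edge
  inj := (h.matching r hr).inj
  tight x hx := by
    have hxM := hx.1.trans_lt h.cur_lt
    have hlt := (h.matching r hr).lt x hx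
    have ht := (h.matching r hr).tight x hx
    have hiff := h.col_iff r hr x hx.1 hx.2
    by_cases hxR : x ∈ R
    · rw [(hU x hxM).1 hxR, (hV _ hlt).1 (hiff.2 hxR)]; linarith
    · rw [(hU x hxM).2 hxR, (hV _ hlt).2 fun h => hxR (hiff.1 h)]; linarith

/-- A matching that covers the rows `S` is extended by the entry `(r, j)`. -/
theorem TightMatching.extend {S S' : Set ℕ} {μ μ' : ℕ → ℕ} (h : TightMatching M F W U V S μ)
    (hS : ∀ x ∈ S', x ≠ r → x ∈ S) (hj : j < M) (hrj : F r j) (ht : U r + V j = W r j)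
    (hne : ∀ x ∈ S', x ≠ r → μ x ≠ j) (hμr : r ∈ S' → μ' r = j)
    (hμ : ∀ x ∈ S', x ≠ r → μ' x = μ x) : TightMatching M F W U V S' μ' where
  lt x hx := by
    by_cases hxr : x = r
    · subst hxr; rwa [hμr hx]
    · rw [hμ x hx hxr]; exact h.lt x (hS x hx hxr)
  edge x hx := by
    by_cases hxr : x = r
    · subst hxr; rwa [hμr hx]
    · rw [hμ x hx hxr]; exact h.edge x (hS x hx hxr)
  tight x hx := by
    by_cases hxr : x = r
    · subst hxr; rwa [hμr hx]
    · rw [hμ x hx hxr]; exact h.tight x (hS x hx hxr)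
  inj x hx y hy hxy := by
    by_cases hxr : x = r <;> by_cases hyr : y = r
    · rw [hxr, hyr]
    · subst hxr
      rw [hμr hx, hμ y hy hyr] at hxy
      exact absurd hxy.symm (hne y hy hyr)
    · subst hyr
      rw [hμr hy, hμ x hx hxr] at hxy
      exact absurd hxy (hne x hx hxr)
    · rw [hμ x hx hxr, hμ y hy hyr] at hxy
      exact h.inj (hS x hx hxr) (hS y hy hyr) hxy

/-- The search reaches a column that is matched to the row `own`. -/
theorem Search.step (h : Search M F W U V cur R C A) (hr : r ∈ R) (hj : j < M) (hjC : j ∉ C)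
    (hrj : F r j) (hδ : δ = W r j - U r - V j)
    (hmin : ∀ i ∈ R, ∀ k < M, k ∉ C → F i k → δ ≤ W i k - U i - V k)
    (hU : ∀ x < M, (x ∈ R → U' x = U x + δ) ∧ (x ∉ R → U' x = U x))
    (hV : ∀ x < M, (x ∈ C → V' x = V x - δ) ∧ (x ∉ C → V' x = V x))
    {own : ℕ} (hown : own < cur) (hAown : A cur own = j)
    (hA : ∀ i ≤ cur, i ≠ own → ∀ x ≤ cur, A' i x = A i x)
    (hAr : A' own r = j) (hAx : ∀ x ≤ cur, x ≠ r → A' own x = A r x) :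
    own ∉ R ∧ Search M F W U' V' cur (insert own R) (insert j C) A' := by
  have hrM := (h.row_le r hr).trans_lt h.cur_lt
  -- A visited row other than `cur` is matched by `A cur` to a visited column, but `j` is unvisited.
  have hownR : own ∉ R := fun ho =>
    hjC (hAown ▸ (h.col_iff cur h.root own hown.le hown.ne).2 ho)
  have hArown : ∀ i ∈ R, A i own = j := fun i hi => by
    rw [h.unvisited i hi own hown.le hownR, hAown]
  -- Every stored matching gives `j` to `own`, hence by injectivity to no other row.
  have hne : ∀ i ∈ R, ∀ x ≤ cur, x ≠ i → x ≠ own → A i x ≠ j := by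
    intro i hi x hx hxi hxo he
    refine hxo ((h.matching i hi).inj ⟨hx, hxi⟩ ⟨hown.le, fun ho => hownR (ho ▸ hi)⟩ ?_)
    rw [he, hArown i hi]
  have hold : ∀ i ∈ R, ∀ x ≤ cur, A' i x = A i x := fun i hi =>
    hA i (h.row_le i hi) fun ho => hownR (ho ▸ hi)
  refine ⟨hownR, h.cur_lt, h.dual_update hr hj hrj hδ hmin hU hV, ?_, Or.inr h.root, ?_, ?_, ?_, ?_⟩
  · rintro x (rfl | hx)
    exacts [hown.le, h.row_le x hx]
  · rintro i (rfl | hi)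
    -- The matching for `own` is `A r` with the column `j` moved from `own` to the uncovered row
    -- `r`.
    · refine (h.matching_update hr hU hV).extend (r := r) (j := j) ?_ hj hrj ?_ ?_ ?_ ?_
      · exact fun x hx hxr => ⟨hx.1, hxr⟩
      · rw [(hU r hrM).1 hr, (hV j hj).2 hjC]; linarith
      · exact fun x hx hxr => hne r hr x hx.1 hxr hx.2
      · exact fun _ => hAr
      · exact fun x hx hxr => hAx x hx.1 hxr
    · exact (h.matching_update hi hU hV).congr fun x hx => hold i hi x hx.1
  · rintro i (rfl | hi) x hx hxi
    · by_cases hxr : x = r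
      · subst hxr
        simp [hAr, hr]
      · rw [hAx x hx hxr, Set.mem_insert_iff, Set.mem_insert_iff, h.col_iff r hr x hx hxr]
        simp [hne r hr x hx hxr hxi, hxi]
    · rw [hold i hi x hx, Set.mem_insert_iff, Set.mem_insert_iff, h.col_iff i hi x hx hxi]
      by_cases hxo : x = own
      · simp [hxo, hArown i hi]
      · simp [hxo, hne i hi x hx hxi hxo]
  · rintro i hi x hx hxR
    rw [Set.mem_insert_iff, not_or] at hxR
    rw [hold cur h.root x hx]
    rcases hi with rfl | hi
    · rw [hAx x hx fun hxr => hxR.2 (hxr ▸ hr), h.unvisited r hr x hx hxR.2]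
    · rw [hold i hi x hx, h.unvisited i hi x hx hxR.2]
  · rintro k (rfl | hk)
    · exact ⟨own, Or.inl rfl, hown.ne, by rw [hold cur h.root own hown.le, hAown]⟩
    · obtain ⟨x, hx, hxc, hxk⟩ := h.col k hk
      exact ⟨x, Or.inr hx, hxc, by rw [hold cur h.root x (h.row_le x hx), hxk]⟩

/-- The search reaches a column that is not matched. -/
theorem Search.finish (h : Search M F W U V cur R C A) (hr : r ∈ R) (hj : j < M) (hjC : j ∉ C)
    (hrj : F r j) (hδ : δ = W r j - U r - V j)
    (hU : ∀ x < M, (x ∈ R → U' x = U x + δ) ∧ (x ∉ R → U' x = U x))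
    (hV : ∀ x < M, (x ∈ C → V' x = V x - δ) ∧ (x ∉ C → V' x = V x))
    (hfree : ∀ x < cur, A cur x ≠ j) {μ : ℕ → ℕ}
    (hμr : μ r = j) (hμ : ∀ x ≤ cur, x ≠ r → μ x = A r x) :
    TightMatching M F W U' V' {x | x < cur + 1} μ := by
  have hrM := (h.row_le r hr).trans_lt h.cur_lt
  refine (h.matching_update hr hU hV).extend (r := r) (j := j) ?_ hj hrj ?_ ?_ ?_ ?_
  · exact fun x hx hxr => ⟨Nat.lt_succ_iff.1 hx, hxr⟩
  · rw [(hU r hrM).1 hr, (hV j hj).2 hjC]; linarith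
  · intro x hx hxr
    have hx : x ≤ cur := Nat.lt_succ_iff.1 hx
    by_cases hxR : x ∈ R
    · exact fun he => hjC (he ▸ (h.col_iff r hr x hx hxr).2 hxR)
    · rw [h.unvisited r hr x hx hxR]
      exact hfree x (lt_of_le_of_ne hx fun he => hxR (he ▸ h.root))
  · exact fun _ => hμr
  · exact fun x hx hxr => hμ x (Nat.lt_succ_iff.1 hx) hxr

end Step

end Assignment

/-! ## The program -/

namespace RAM

/-! Arrays of natural numbers. The parameters of the current block are `aC`, `aS`, `aQ`; `aLen` is
its length and `aBase` is `c * M`. `aOff` holds the multiples of `M`, which are the offsets of the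
rows of a matrix. -/

notation "aIn" => (0 : ℕ)
notation "aOut" => (1 : ℕ)
notation "aOrder" => (2 : ℕ)
notation "aC" => (3 : ℕ)
notation "aS" => (4 : ℕ)
notation "aQ" => (5 : ℕ)
notation "aLen" => (6 : ℕ)
notation "aBase" => (7 : ℕ)
notation "aI" => (8 : ℕ)
notation "aJ" => (9 : ℕ)
notation "aK" => (10 : ℕ)
notation "aList" => (11 : ℕ)
notation "aPtr" => (12 : ℕ)
notation "aFlag" => (13 : ℕ)
notation "aOff" => (14 : ℕ)
notation "aCur" => (15 : ℕ)
notation "aRow" => (16 : ℕ)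
notation "aCol" => (17 : ℕ)
notation "aMatch" => (18 : ℕ)
notation "aFound" => (19 : ℕ)
notation "aMinRow" => (20 : ℕ)
notation "aMinCol" => (21 : ℕ)
notation "aOwn" => (22 : ℕ)
notation "aAns" => (23 : ℕ)

/-! Arrays of reals; the answers of calls are in `aAns`. -/

notation "xPower" => (0 : ℕ)
notation "xBest" => (1 : ℕ)
notation "xCost" => (2 : ℕ)
notation "xRow" => (3 : ℕ)
notation "xCol" => (4 : ℕ)
notation "xDelta" => (5 : ℕ)
notation "xSum" => (6 : ℕ)
notation "xTotal" => (7 : ℕ)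

namespace Code

open Program

/-- The number of users. -/
abbrev users : NatExp := .get aIn

/-- The number of channels. -/
abbrev chans : NatExp := .read aIn (.const 1)

/-- The index of a matrix entry. -/
abbrev entry (i j : NatExp) : NatExp := .add (.read aOff i) j

/-- Run a list of programs. -/
def block : List Program → Program
  | [] => .skip
  | [P] => P
  | P :: Q :: L => .seq P (block (Q :: L))

/-- The reduced cost of the entry `(aI, aJ)`. -/
abbrev reduced : RealExp :=
  .sub (.sub (.read xCost (entry (.get aI) (.get aJ))) (.read xRow (.get aI)))
    (.read xCol (.get aJ))

/-- Compare the entry `(aI, aJ)` with the best entry found. -/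
def scanEntry : Program :=
  .branch
    (.conj (.set (.read aRow (.get aI)))
      (.conj (.neg (.set (.read aCol (.get aJ)))) (.set (.read aFlag (entry (.get aI) (.get aJ))))))
    (.branch (.conj (.set (.get aFound)) (.realLe (.read xDelta (.const 0)) reduced)) .skip
      (block [put aFound (.const 1), .setReal xDelta (.const 0) reduced,
        put aMinRow (.get aI), put aMinCol (.get aJ)]))
    .skip

def scanRow : Program := forLoop aJ users scanEntry

/-- Find an entry of least reduced cost in a visited row and an unvisited column. -/
def scan : Program := .seq (put aFound (.const 0)) (forLoop aI users scanRow)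

/-- Adjust the potentials of the row and the column `aI`. -/
def shiftOne : Program :=
  .seq
    (.branch (.set (.read aRow (.get aI)))
      (.setReal xRow (.get aI) (.add (.read xRow (.get aI)) (.read xDelta (.const 0)))) .skip)
    (.branch (.set (.read aCol (.get aI)))
      (.setReal xCol (.get aI) (.sub (.read xCol (.get aI)) (.read xDelta (.const 0)))) .skip)

def shift : Program := forLoop aI users shiftOne

def findOwnerOne : Program :=
  .branch
    (.conj (.natLe (.read aMatch (entry (.get aCur) (.get aI))) (.get aMinCol))
      (.natLe (.get aMinCol) (.read aMatch (entry (.get aCur) (.get aI)))))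
    (put aOwn (.get aI)) .skip

/-- Find the row that is matched to the column `aMinCol`, or `aCur + 1` if there is none. -/
def findOwner : Program :=
  .seq (put aOwn (.add (.get aCur) (.const 1))) (forLoop aI (.get aCur) findOwnerOne)

def copyOne : Program :=
  .setNat aMatch (entry (.get aOwn) (.get aI)) (.read aMatch (entry (.get aMinRow) (.get aI)))

/-- Store the matching that leaves the row `aOwn` uncovered. -/
def copyMatching : Program :=
  .seq (forLoop aI users copyOne)
    (.setNat aMatch (entry (.get aOwn) (.get aMinRow)) (.get aMinCol))

def visit : Program :=
  .seq (.setNat aRow (.get aOwn) (.const 1)) (.setNat aCol (.get aMinCol) (.const 1))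

def searchStep : Program :=
  .seq scan (.branch (.set (.get aFound))
    (.seq shift (.seq findOwner (.seq copyMatching visit))) .skip)

def resetOne : Program :=
  .seq (.setNat aRow (.get aI) (.const 0)) (.setNat aCol (.get aI) (.const 0))

def reset : Program :=
  .seq (forLoop aI users resetOne)
    (.seq (.setNat aRow (.get aCur) (.const 1)) (put aOwn (.get aCur)))

/-- While the search runs, `aOwn` is the row visited last. The value `aCur + 1` signals that a free
column was reached, and `aFound = 0` that no admissible entry is left. -/
abbrev searchTest : Test := .conj (.natLe (.get aOwn) (.get aCur)) (.set (.get aFound))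

/-- Insert the row `aCur`. -/
def insertRow : Program :=
  -- After the loop `aFound` is `1` or `0`, so the row counter advances exactly on success.
  .seq reset (.seq (.loop searchTest searchStep) (put aCur (.add (.get aCur) (.get aFound))))

def clearOne : Program :=
  .seq (.setReal xRow (.get aI) .zero) (.setReal xCol (.get aI) .zero)

/-- Solve the assignment problem for the entries of `xCost` with a flag in `aFlag`. -/
def assign : Program :=
  .seq (forLoop aI users clearOne) (.seq (put aCur (.const 0)) (.seq (put aFound (.const 1))
    (.loop (.conj (.lt (.get aCur) users) (.set (.get aFound))) insertRow)))

def listOne : Program :=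
  .seq (.setNat aList (.get aK) (.get aPtr)) (put aPtr (.add (.get aPtr) (.add users (.get aS))))

/-- List the channels of the user with order `aJ`. -/
def listChannels : Program :=
  .seq (put aPtr (.add (.get aQ) (.get aJ))) (forLoop aK (.get aC) listOne)

/-- Find the power of the user `aI` with order `aJ`. -/
def fillEntry : Program :=
  .seq listChannels (.seq (.call (.get aI) aList (.get aC) aAns)
    (.seq (.setReal xCost (entry (.get aI) (.get aJ)) (.read aAns (.const 0)))
      (.setNat aFlag (entry (.get aI) (.get aJ)) (.get aAns))))

/-- In the absence of multiplication the row offsets are produced by one addition per row. -/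
def fillRow : Program :=
  .seq (forLoop aJ users fillEntry)
    (.setNat aOff (.add (.get aI) (.const 1)) (.add (.read aOff (.get aI)) users))

/-- Compute the cost matrix of the current block. -/
def fill : Program := .seq (.setNat aOff (.const 0) (.const 0)) (forLoop aI users fillRow)

/-- The column that is assigned to the row `aI`. -/
abbrev assigned : NatExp := .read aMatch (entry users (.get aI))

def sumOne : Program :=
  .setReal xSum (.const 0)
    (.add (.read xSum (.const 0)) (.read xCost (entry (.get aI) assigned)))

def sumUp : Program := .seq (.setReal xSum (.const 0) .zero) (forLoop aI users sumOne)

/-- The factor `c` of the total power is realised by repeated addition. -/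
def totalOne : Program :=
  .setReal xTotal (.const 0) (.add (.read xTotal (.const 0)) (.read xSum (.const 0)))

def total : Program := .seq (.setReal xTotal (.const 0) .zero) (forLoop aK (.get aC) totalOne)

def recordOne : Program :=
  .seq (.setNat aOrder (.get aI) assigned)
    (.setReal xPower (.get aI) (.read xCost (entry (.get aI) assigned)))

/-- Record the current allocation. -/
def record : Program :=
  .seq (forLoop aI users recordOne)
    (block [.setNat aOut (.const 0) (.const 1), .setNat aOut (.const 1) (.get aC),
      .setNat aOut (.const 2) (.get aS), .setNat aOut (.const 3) (.get aQ),
      .setReal xBest (.const 0) (.read xTotal (.const 0))])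

/-- Record the current allocation if it is better than the recorded one. -/
def accept : Program :=
  .seq sumUp (.seq total
    (.branch (.conj (.set (.get aOut)) (.realLe (.read xBest (.const 0)) (.read xTotal (.const 0))))
      .skip record))

/-- Find the best allocation for the current block. -/
def tryBlock : Program := .seq fill (.seq assign (.branch (.set (.get aFound)) accept .skip))

abbrev increment (a : ℕ) : Program := put a (.add (.get a) (.const 1))

/-- Run through all values of `aQ`. -/
def tryOffsets : Program :=
  .seq (put aQ (.const 0))
    (.loop (.natLe (.add (.get aQ) (.get aLen)) chans) (.seq tryBlock (increment aQ)))

/-- Raising `s` by one lengthens the block by `c - 1`. For `c = 1` only `s = 0` is valid, and the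
length `N + 1` is written to stop the loop over the gaps. -/
def tryGap : Program :=
  .seq tryOffsets (.seq
    (.branch (.natLe (.get aC) (.const 1)) (put aLen (.add chans (.const 1)))
      (put aLen (.add (.get aLen) (.sub (.get aC) (.const 1)))))
    (increment aS))

/-- Run through all values of `aS`. -/
def tryGaps : Program :=
  .seq (put aS (.const 0)) (.seq (put aLen (.get aBase)) (.loop (.natLe (.get aLen) chans) tryGap))

def tryCount : Program :=
  .seq tryGaps (.seq (increment aC) (put aBase (.add (.get aBase) users)))

/-- Run through all blocks. -/
def minPower : Program :=
  .seq (put aC (.const 1)) (.seq (put aBase users) (.loop (.natLe (.get aBase) chans) tryCount))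

end Code

/-! ### Verification of the scan for the least reduced cost -/

open Code Assignment

/-- The memory holds the cost matrix of an assignment problem. -/
structure Table (M : ℕ) (F : ℕ → ℕ → Prop) (W : ℕ → ℕ → ℝ) (σ : State) : Prop where
  users : σ.nat aIn 0 = M
  -- The index `M` is included because the matching of all rows ends up in row `M` of `aMatch`.
  off : ∀ i ≤ M, σ.nat aOff i = i * M
  flag : ∀ i < M, ∀ j < M, 1 ≤ σ.nat aFlag (i * M + j) ↔ F i j
  cost : ∀ i < M, ∀ j < M, σ.real xCost (i * M + j) = W i j

variable {O : ℕ → Finset ℕ → Option ℝ} {M : ℕ} {F : ℕ → ℕ → Prop} {W : ℕ → ℕ → ℝ} {σ τ : State}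

theorem Table.of_eq (h : Table M F W σ) (h1 : τ.nat aIn = σ.nat aIn)
    (h2 : τ.nat aOff = σ.nat aOff) (h3 : τ.nat aFlag = σ.nat aFlag)
    (h4 : τ.real xCost = σ.real xCost) : Table M F W τ :=
  ⟨by rw [h1, h.users], by rw [h2]; exact h.off, by rw [h3]; exact h.flag,
    by rw [h4]; exact h.cost⟩

theorem Table.of_agree {P : Program} (h : Table M F W σ) (ha : Agree P σ τ)
    (hn : ∀ a ∈ [aIn, aOff, aFlag], a ∉ P.natTargets) (hr : xCost ∉ P.realTargets) :
    Table M F W τ :=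
  h.of_eq (ha.nat _ (hn _ (by simp))) (ha.nat _ (hn _ (by simp))) (ha.nat _ (hn _ (by simp)))
    (ha.real _ hr)

/-- The best entry among the entries in `S`. -/
def BestEntry (M : ℕ) (F : ℕ → ℕ → Prop) (W : ℕ → ℕ → ℝ) (S : ℕ → ℕ → Prop) (σ : State) : Prop :=
  (σ.nat aFound 0 = 0 ∧ ∀ i < M, ∀ j < M, S i j →
    ¬ (1 ≤ σ.nat aRow i ∧ ¬ 1 ≤ σ.nat aCol j ∧ F i j)) ∨
  (σ.nat aFound 0 = 1 ∧ σ.nat aMinRow 0 < M ∧ σ.nat aMinCol 0 < M ∧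
    1 ≤ σ.nat aRow (σ.nat aMinRow 0) ∧ ¬ 1 ≤ σ.nat aCol (σ.nat aMinCol 0) ∧
    F (σ.nat aMinRow 0) (σ.nat aMinCol 0) ∧
    σ.real xDelta 0 = W (σ.nat aMinRow 0) (σ.nat aMinCol 0) - σ.real xRow (σ.nat aMinRow 0)
      - σ.real xCol (σ.nat aMinCol 0) ∧
    ∀ i < M, ∀ j < M, S i j → 1 ≤ σ.nat aRow i → ¬ 1 ≤ σ.nat aCol j → F i j →
      σ.real xDelta 0 ≤ W i j - σ.real xRow i - σ.real xCol j)

theorem wp_scanEntry {S : ℕ → ℕ → Prop} (h : Table M F W σ) (hS : BestEntry M F W S σ)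
    (hi : σ.nat aI 0 < M) (hj : σ.nat aJ 0 < M) :
    Wp O scanEntry σ fun τ t =>
      BestEntry M F W (fun i j => S i j ∨ i = σ.nat aI 0 ∧ j = σ.nat aJ 0) τ ∧ t ≤ 100 := by
  have hoff := h.off _ hi.le
  have hF := h.flag _ hi _ hj
  have hW := h.cost _ hi _ hj
  simp only [scanEntry, block, wp_branch, wp_seq, wp_setNat, wp_setReal, wp_skip]
  simp only [NatExp.eval, RealExp.eval, Test.Holds, NatExp.cost, RealExp.cost, Test.cost, hoff,
    hF, hW]
  refine ⟨fun hc => ⟨fun hd => ⟨?_, by norm_num⟩, fun hd => ⟨?_, by norm_num⟩⟩,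
    fun hc => ⟨?_, by norm_num⟩⟩
  · rcases hS with ⟨h0, -⟩ | ⟨h1, h2, h3, h4, h5, h6, h7, h8⟩
    · omega
    · refine Or.inr ⟨h1, h2, h3, h4, h5, h6, h7, ?_⟩
      rintro i hi j hj (hs | ⟨rfl, rfl⟩) hr hk hf
      exacts [h8 i hi j hj hs hr hk hf, hd.2]
  · refine Or.inr ?_
    simp only [ne_eq, write_self, if_true, write_of_ne, Nat.reduceEqDiff,
      not_false_eq_true, hoff, hW]
    refine ⟨trivial, hi, hj, hc.1, hc.2.1, hc.2.2, trivial, ?_⟩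
    rintro i hi j hj (hs | ⟨rfl, rfl⟩) hr hk hf
    · rcases hS with ⟨h0, h1⟩ | ⟨h1, -, -, -, -, -, -, h8⟩
      · exact absurd ⟨hr, hk, hf⟩ (h1 i hi j hj hs)
      · have := h8 i hi j hj hs hr hk hf
        -- An entry was already recorded, so the failed test means that the new reduced cost is
        -- strictly smaller.
        have : ¬ _ := fun hle => hd ⟨h1.ge, hle⟩
        linarith
    · exact le_rfl
  · rcases hS with ⟨h0, h1⟩ | ⟨h1, h2, h3, h4, h5, h6, h7, h8⟩
    · refine Or.inl ⟨h0, ?_⟩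
      rintro i hi j hj (hs | ⟨rfl, rfl⟩)
      exacts [h1 i hi j hj hs, hc]
    · refine Or.inr ⟨h1, h2, h3, h4, h5, h6, h7, ?_⟩
      rintro i hi j hj (hs | ⟨rfl, rfl⟩) hr hk hf
      exacts [h8 i hi j hj hs hr hk hf, absurd ⟨hr, hk, hf⟩ hc]

theorem BestEntry.congr {S S' : ℕ → ℕ → Prop} (h : BestEntry M F W S σ)
    (hS : ∀ i < M, ∀ j < M, S' i j → S i j)
    (hn : ∀ a ∈ [aFound, aMinRow, aMinCol, aRow, aCol], τ.nat a = σ.nat a)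
    (hr : τ.real = σ.real) : BestEntry M F W S' τ := by
  simp only [List.mem_cons, List.not_mem_nil, or_false, forall_eq_or_imp, forall_eq] at hn
  obtain ⟨h1, h2, h3, h4, h5⟩ := hn
  unfold BestEntry at *
  rw [h1, h2, h3, h4, h5, hr]
  rcases h with ⟨h0, h1⟩ | ⟨h1, h2, h3, h4, h5, h6, h7, h8⟩
  · exact Or.inl ⟨h0, fun i hi j hj hs => h1 i hi j hj (hS i hi j hj hs)⟩
  · exact Or.inr ⟨h1, h2, h3, h4, h5, h6, h7, fun i hi j hj hs => h8 i hi j hj (hS i hi j hj hs)⟩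

theorem wp_scanRow {S : ℕ → ℕ → Prop} (h : Table M F W σ) (hS : BestEntry M F W S σ)
    (hi : σ.nat aI 0 < M) :
    Wp O scanRow σ fun τ t =>
      BestEntry M F W (fun i j => S i j ∨ i = σ.nat aI 0) τ ∧ t ≤ M * 114 + 11 := by
  refine (wp_forLoop M 100 (fun k σ' =>
    BestEntry M F W (fun i j => S i j ∨ i = σ.nat aI 0 ∧ j < k) σ') (by decide) ?_ ?_ ?_).mono ?_
  · intro σ' ha
    simp [ha.nat 0 (by decide), h.users]
  · exact hS.congr (by simp) (by simp) rfl
  · intro k hk σ' ha hj hInv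
    have hI : σ'.nat aI = σ.nat aI := ha.nat _ (by decide)
    refine (wp_scanEntry (h.of_agree ha (by decide) (by decide)) hInv (by rwa [hI])
      (by rwa [hj])).mono fun τ t ⟨hb, ht⟩ => ⟨?_, ht⟩
    refine hb.congr ?_ (by simp) rfl
    rw [hI, hj]
    rintro i - j - (hs | ⟨rfl, hjk⟩)
    · exact Or.inl (Or.inl hs)
    · rcases Nat.lt_succ_iff_lt_or_eq.1 hjk with hlt | rfl
      exacts [Or.inl (Or.inr ⟨rfl, hlt⟩), Or.inr ⟨rfl, rfl⟩]
  · rintro τ t ⟨hb, ht, -⟩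
    exact ⟨hb.congr (fun i _ j hj hs => hs.imp_right fun h => ⟨h, hj⟩) (by simp) rfl, by simpa using ht⟩

theorem wp_scan (h : Table M F W σ) :
    Wp O scan σ fun τ t => BestEntry M F W (fun _ _ => True) τ ∧
      t ≤ M * (M * 114 + 25) + 15 := by
  rw [scan, wp_seq, wp_setNat]
  refine (wp_forLoop M (M * 114 + 11) (fun k σ' =>
    BestEntry M F W (fun i _ => i < k) σ') (by decide) ?_ ?_ ?_).mono ?_
  · intro σ' ha
    simp [ha.nat 0 (by decide), h.users]
  · left; simp
  · intro k hk σ' ha hj hInv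
    refine (wp_scanRow ?_ hInv (by rwa [hj])).mono fun τ t ⟨hb, ht⟩ => ⟨?_, ht⟩
    · exact (h.of_eq (τ := ⟨write σ.nat aFound 0 0, σ.real⟩) (by simp) (by simp) (by simp) rfl).of_agree
        ha (by decide) (by decide)
    · refine hb.congr ?_ (by simp) rfl
      rw [hj]
      exact fun i _ _ _ hik => Nat.lt_succ_iff_lt_or_eq.1 hik
  · rintro τ t ⟨hb, ht, -⟩
    refine ⟨hb.congr (fun i hi j hj hs => hi) (by simp) rfl, ?_⟩
    simp only [NatExp.cost] at ht ⊢
    linarith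

end RAM

/-! ### Verification of one step of the Hungarian search -/

namespace RAM

open Code Assignment

variable {O : ℕ → Finset ℕ → Option ℝ} {M : ℕ} {F : ℕ → ℕ → Prop} {W : ℕ → ℕ → ℝ} {σ τ : State}

theorem wp_shift (hM : σ.nat aIn 0 = M) :
    Wp O shift σ fun τ t =>
      (∀ x < M, (1 ≤ σ.nat aRow x → τ.real xRow x = σ.real xRow x + σ.real xDelta 0) ∧
        (¬ 1 ≤ σ.nat aRow x → τ.real xRow x = σ.real xRow x)) ∧
      (∀ x < M, (1 ≤ σ.nat aCol x → τ.real xCol x = σ.real xCol x - σ.real xDelta 0) ∧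
        (¬ 1 ≤ σ.nat aCol x → τ.real xCol x = σ.real xCol x)) ∧ t ≤ M * 64 + 11 := by
  refine (wp_forLoop M 50 (fun k σ' =>
      -- The negative half says that cells from `k` on still hold their initial values, so that none
      -- is shifted twice.
      (∀ x, (x < k ∧ 1 ≤ σ.nat aRow x → σ'.real xRow x = σ.real xRow x + σ.real xDelta 0) ∧
        (¬ (x < k ∧ 1 ≤ σ.nat aRow x) → σ'.real xRow x = σ.real xRow x)) ∧
      (∀ x, (x < k ∧ 1 ≤ σ.nat aCol x → σ'.real xCol x = σ.real xCol x - σ.real xDelta 0) ∧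
        (¬ (x < k ∧ 1 ≤ σ.nat aCol x) → σ'.real xCol x = σ.real xCol x)))
    (by decide) ?_ ?_ ?_).mono ?_
  · intro σ' ha
    simp [ha.nat 0 (by decide), hM]
  · simp
  · rintro k hk σ' ha hI ⟨hU, hV⟩
    have hR : σ'.nat aRow = σ.nat aRow := ha.nat _ (by decide)
    have hC : σ'.nat aCol = σ.nat aCol := ha.nat _ (by decide)
    have hD : σ'.real xDelta = σ.real xDelta := ha.real _ (by decide)
    have hUk : σ'.real xRow k = σ.real xRow k := (hU k).2 (by simp)
    have hVk : σ'.real xCol k = σ.real xCol k := (hV k).2 (by simp)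
    have hU' : ∀ x, x ≠ k → (x < k + 1 ↔ x < k) := fun x hx => by omega
    simp only [shiftOne, wp_branch, wp_seq, wp_setReal, wp_skip]
    by_cases h1 : 1 ≤ σ.nat aRow k <;> by_cases h2 : 1 ≤ σ.nat aCol k <;>
    · simp only [NatExp.eval, RealExp.eval, Test.Holds, NatExp.cost, RealExp.cost, Test.cost, hI,
        hR, hC, hD, h1, h2, not_true, not_false_iff, true_implies, false_implies, true_and,
        and_true, write_self, write_of_ne, ne_eq, Nat.reduceEqDiff, hUk, hVk]
      refine ⟨⟨fun x => ?_, fun x => ?_⟩, by norm_num⟩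
      all_goals
        by_cases hx : x = k
        · subst hx; simp [h1, h2, hUk, hVk]
        · rw [hU' x hx]; try simp only [hx, if_false]
          first | exact hU x | exact hV x
  · rintro τ t ⟨⟨hU, hV⟩, ht, -⟩
    refine ⟨fun x hx => ?_, fun x hx => ?_, by simpa using ht⟩
    · simpa [hx] using hU x
    · simpa [hx] using hV x

/-- Only rows below `cur` are inspected, since `cur` is uncovered in its own matching. The default
`cur + 1` is also the row of `aMatch` in which the completed matching belongs. -/
theorem wp_findOwner (h : Table M F W σ) (hcur : σ.nat aCur 0 < M) :
    Wp O findOwner σ fun τ t =>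
      ((τ.nat aOwn 0 < σ.nat aCur 0 ∧
          σ.nat aMatch (σ.nat aCur 0 * M + τ.nat aOwn 0) = σ.nat aMinCol 0) ∨
        (τ.nat aOwn 0 = σ.nat aCur 0 + 1 ∧
          ∀ x < σ.nat aCur 0, σ.nat aMatch (σ.nat aCur 0 * M + x) ≠ σ.nat aMinCol 0)) ∧
      t ≤ M * 64 + 20 := by
  rw [findOwner, wp_seq, wp_setNat]
  refine (wp_forLoop (σ.nat aCur 0) 50 (fun k σ' =>
      (σ'.nat aOwn 0 < σ.nat aCur 0 ∧
          σ.nat aMatch (σ.nat aCur 0 * M + σ'.nat aOwn 0) = σ.nat aMinCol 0) ∨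
        (σ'.nat aOwn 0 = σ.nat aCur 0 + 1 ∧
          ∀ x < k, σ.nat aMatch (σ.nat aCur 0 * M + x) ≠ σ.nat aMinCol 0))
    (by decide) ?_ ?_ ?_).mono ?_
  · intro σ' ha
    simp [ha.nat aCur (by decide)]
  · simp
  · rintro k hk σ' ha hI hInv
    have h1 : σ'.nat aCur = σ.nat aCur := by simp [ha.nat aCur (by decide)]
    have h2 : σ'.nat aMatch = σ.nat aMatch := by simp [ha.nat aMatch (by decide)]
    have h3 : σ'.nat aMinCol = σ.nat aMinCol := by simp [ha.nat aMinCol (by decide)]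
    have h4 : σ'.nat aOff = σ.nat aOff := by simp [ha.nat aOff (by decide)]
    simp only [findOwnerOne, wp_branch, wp_setNat, wp_skip]
    simp only [NatExp.eval, Test.Holds, NatExp.cost, Test.cost, hI, h1, h2, h3, h4,
      h.off _ hcur.le, write_self, write_of_ne, ne_eq, Nat.reduceEqDiff, not_false_iff, if_true]
    refine ⟨fun hc => ⟨Or.inl ⟨hk, le_antisymm hc.1 hc.2⟩, by norm_num⟩, fun hc => ⟨?_, by norm_num⟩⟩
    refine hInv.imp_right fun ⟨ho, hx⟩ => ⟨ho, fun x hxk => ?_⟩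
    rcases Nat.lt_succ_iff_lt_or_eq.1 hxk with hlt | rfl
    · exact hx x hlt
    · exact fun he => hc ⟨he.le, he.ge⟩
  · rintro τ t ⟨hInv, ht, -⟩
    refine ⟨hInv, ?_⟩
    simp only [NatExp.cost] at ht ⊢
    omega

theorem mul_add_inj {M i i' x x' : ℕ} (hx : x < M) (hx' : x' < M) :
    i * M + x = i' * M + x' ↔ i = i' ∧ x = x' := by
  constructor
  · intro h
    have h1 := congrArg (· / M) h
    have h2 := congrArg (· % M) h
    have hM : 0 < M := by omega
    simp only [Nat.add_div_of_dvd_right (Dvd.intro_left _ rfl), Nat.mul_div_cancel _ hM,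
      Nat.div_eq_of_lt hx, Nat.div_eq_of_lt hx', Nat.mul_add_mod', Nat.mod_eq_of_lt hx,
      Nat.mod_eq_of_lt hx'] at h1 h2
    exact ⟨h1, h2⟩
  · rintro ⟨rfl, rfl⟩; rfl

/-- The target row differs from the source row, so the source is intact during the copy. The target
may be row `M`, when the last matching is completed. -/
theorem wp_copyMatching (h : Table M F W σ) (hown : σ.nat aOwn 0 ≤ M)
    (hr : σ.nat aMinRow 0 < M) (hne : σ.nat aOwn 0 ≠ σ.nat aMinRow 0) :
    Wp O copyMatching σ fun τ t =>
      (∀ i ≠ σ.nat aOwn 0, ∀ x < M, τ.nat aMatch (i * M + x) = σ.nat aMatch (i * M + x)) ∧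
      τ.nat aMatch (σ.nat aOwn 0 * M + σ.nat aMinRow 0) = σ.nat aMinCol 0 ∧
      (∀ x < M, x ≠ σ.nat aMinRow 0 → τ.nat aMatch (σ.nat aOwn 0 * M + x) =
        σ.nat aMatch (σ.nat aMinRow 0 * M + x)) ∧ t ≤ M * 50 + 40 := by
  rw [copyMatching, wp_seq]
  refine (wp_forLoop M 30 (fun k σ' =>
      (∀ i ≠ σ.nat aOwn 0, ∀ x < M, σ'.nat aMatch (i * M + x) = σ.nat aMatch (i * M + x)) ∧
      (∀ x < k, x < M → σ'.nat aMatch (σ.nat aOwn 0 * M + x) =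
        σ.nat aMatch (σ.nat aMinRow 0 * M + x)))
    (by decide) ?_ ?_ ?_).mono ?_
  · intro σ' ha
    simp [ha.nat 0 (by decide), h.users]
  · simp
  · rintro k hk σ' ha hI ⟨hi1, hi2⟩
    have h1 : σ'.nat aOwn = σ.nat aOwn := ha.nat _ (by decide)
    have h2 : σ'.nat aMinRow = σ.nat aMinRow := ha.nat _ (by decide)
    have h4 : σ'.nat aOff = σ.nat aOff := ha.nat _ (by decide)
    simp only [copyOne, wp_setNat]
    simp only [NatExp.eval, NatExp.cost, hI, h1, h2, h4, h.off _ hown, h.off _ hr.le, write_self,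
      write_of_ne, ne_eq, Nat.reduceEqDiff, not_false_iff]
    refine ⟨⟨fun i hi x hx => ?_, fun x hxk hx => ?_⟩, by norm_num⟩
    · simp only [mul_add_inj hx hk]
      rw [if_neg (fun h => hi h.1), hi1 i hi x hx]
    · simp only [mul_add_inj hx hk]
      rcases Nat.lt_succ_iff_lt_or_eq.1 hxk with hlt | rfl
      · rw [if_neg (fun h => hlt.ne h.2), hi2 x hlt hx]
      · rw [if_pos (by simp), hi1 _ hne.symm x hx]
  · rintro τ t ⟨⟨hi1, hi2⟩, ht, ha⟩
    have h1 : τ.nat aOwn = σ.nat aOwn := ha.nat _ (by decide)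
    have h2 : τ.nat aMinRow = σ.nat aMinRow := ha.nat _ (by decide)
    have h3 : τ.nat aMinCol = σ.nat aMinCol := ha.nat _ (by decide)
    have h4 : τ.nat aOff = σ.nat aOff := ha.nat _ (by decide)
    simp only [wp_setNat]
    simp only [NatExp.eval, NatExp.cost, h1, h2, h3, h4, h.off _ hown, write_self, if_true,
      true_and] at ht ⊢
    refine ⟨fun i hi x hx => ?_, fun x hx hxr => ?_, by omega⟩
    · simp only [mul_add_inj hx hr]
      rw [if_neg (fun h => hi h.1), hi1 i hi x hx]
    · simp only [mul_add_inj hx hr]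
      rw [if_neg (fun h => hxr h.2), hi2 x hx hx]

/-- The matchings stored in the memory. -/
abbrev State.matching (M : ℕ) (σ : State) (r x : ℕ) : ℕ := σ.nat aMatch (r * M + x)

/-- The sets are cut off at `M` because flags beyond it are never reset: at the end of a search
`visit` also flags the row `cur + 1`, which can be `M`. -/
abbrev SearchAt (M : ℕ) (F : ℕ → ℕ → Prop) (W : ℕ → ℕ → ℝ) (σ : State) : Prop :=
  Search M F W (σ.real xRow) (σ.real xCol) (σ.nat aCur 0) {x | x < M ∧ 1 ≤ σ.nat aRow x}
    {x | x < M ∧ 1 ≤ σ.nat aCol x} (σ.matching M)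

/-- The memory holds a tight matching of the first `k` rows. -/
structure MatchingAt (M : ℕ) (F : ℕ → ℕ → Prop) (W : ℕ → ℕ → ℝ) (k : ℕ) (σ : State) : Prop where
  dual : IsDual M F W (σ.real xRow) (σ.real xCol)
  matching : TightMatching M F W (σ.real xRow) (σ.real xCol) {x | x < k} (σ.matching M k)

/-- There is no perfect matching. -/
def NoMatching (M : ℕ) (F : ℕ → ℕ → Prop) : Prop :=
  ∀ ν : ℕ → ℕ, (∀ x < M, ν x < M) → (∀ x < M, F x (ν x)) → ¬ Set.InjOn ν {x | x < M}

/-- The loop test holds exactly in the case `running`. In `done` the completed matching lies at the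
index from which the next insertion starts. -/
inductive SearchResult (M : ℕ) (F : ℕ → ℕ → Prop) (W : ℕ → ℕ → ℝ) (σ : State) : Prop
  | running : σ.nat aFound 0 = 1 → σ.nat aOwn 0 ≤ σ.nat aCur 0 → SearchAt M F W σ →
      SearchResult M F W σ
  | done : σ.nat aFound 0 = 1 → σ.nat aOwn 0 = σ.nat aCur 0 + 1 →
      MatchingAt M F W (σ.nat aCur 0 + 1) σ → SearchResult M F W σ
  | stuck : σ.nat aFound 0 = 0 → NoMatching M F → SearchResult M F W σ

/-- An upper bound for the number of steps of the search. -/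
def State.searchVariant (σ : State) : ℕ :=
  if σ.nat aOwn 0 ≤ σ.nat aCur 0 ∧ 1 ≤ σ.nat aFound 0 then
    ((Finset.range (σ.nat aCur 0 + 1)).filter fun x => σ.nat aRow x = 0).card + 1
  else 0

/-- The scan dominates with O(M²) steps. A step either visits a row that was unvisited or ends the
search, so the variant drops. -/
theorem wp_searchStep (h : Table M F W σ) (hs : SearchAt M F W σ)
    (hown : σ.nat aOwn 0 ≤ σ.nat aCur 0) (hf : σ.nat aFound 0 = 1) :
    Wp O searchStep σ fun τ t => SearchResult M F W τ ∧ τ.searchVariant < σ.searchVariant ∧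
      t ≤ 500 * M ^ 2 := by
  have hcur := hs.cur_lt
  have hM2 : M ≤ M ^ 2 := by nlinarith
  have hM1 : 1 ≤ M ^ 2 := by nlinarith
  have hpos : σ.searchVariant = ((Finset.range (σ.nat aCur 0 + 1)).filter
      fun x => σ.nat aRow x = 0).card + 1 := if_pos ⟨hown, hf.ge⟩
  rw [searchStep, wp_seq]
  refine (wp_scan h).agree.mono fun σ₁ t₁ ⟨⟨hb, ht₁⟩, ha₁⟩ => ?_
  have hT₁ := h.of_agree ha₁ (by decide) (by decide)
  have e1 : σ₁.nat aCur = σ.nat aCur := ha₁.nat _ (by decide)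
  have e2 : σ₁.nat aRow = σ.nat aRow := ha₁.nat _ (by decide)
  have e3 : σ₁.nat aCol = σ.nat aCol := ha₁.nat _ (by decide)
  have e4 : σ₁.nat aMatch = σ.nat aMatch := ha₁.nat _ (by decide)
  have e5 : σ₁.real xRow = σ.real xRow := ha₁.real _ (by decide)
  have e6 : σ₁.real xCol = σ.real xCol := ha₁.real _ (by decide)
  rw [wp_branch]
  rcases hb with ⟨hf₁, hno⟩ | ⟨hf₁, hrM, hcM, hr, hc, hrc, hδ, hmin⟩
  · refine ⟨fun hh => absurd hh (by simp [hf₁]), fun _ => ?_⟩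
    rw [wp_skip]
    refine ⟨.stuck hf₁ ?_, ?_, ?_⟩
    · intro ν h1 h2 h3
      refine hs.not_exists_matching ?_ ν h1 h2 h3
      intro i hi j hj hjC hF
      exact hno i hi.1 j hj trivial ⟨by rw [e2]; exact hi.2, fun hh => hjC ⟨hj, by rwa [← e3]⟩, hF⟩
    · rw [hpos, State.searchVariant, if_neg (by simp [hf₁])]
      omega
    · simp only [Test.cost, NatExp.cost]
      nlinarith
  refine ⟨fun _ => ?_, fun hh => absurd (by simp [hf₁]) hh⟩
  rw [wp_seq]
  refine (wp_shift hT₁.users).agree.mono fun σ₂ t₂ ⟨⟨hU, hV, ht₂⟩, ha₂⟩ => ?_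
  have hT₂ := hT₁.of_agree ha₂ (by decide) (by decide)
  have e21 : σ₂.nat aCur = σ.nat aCur := (ha₂.nat _ (by decide)).trans e1
  have e22 : σ₂.nat aRow = σ.nat aRow := (ha₂.nat _ (by decide)).trans e2
  have e23 : σ₂.nat aCol = σ.nat aCol := (ha₂.nat _ (by decide)).trans e3
  have e24 : σ₂.nat aMatch = σ.nat aMatch := (ha₂.nat _ (by decide)).trans e4
  have e25 : σ₂.nat aMinRow = σ₁.nat aMinRow := ha₂.nat _ (by decide)
  have e26 : σ₂.nat aMinCol = σ₁.nat aMinCol := ha₂.nat _ (by decide)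
  have e27 : σ₂.nat aFound = σ₁.nat aFound := ha₂.nat _ (by decide)
  rw [wp_seq]
  refine (wp_findOwner hT₂ (by rwa [e21])).agree.mono fun σ₃ t₃ ⟨⟨ho, ht₃⟩, ha₃⟩ => ?_
  have hT₃ := hT₂.of_agree ha₃ (by decide) (by decide)
  have e31 : σ₃.nat aCur = σ.nat aCur := (ha₃.nat _ (by decide)).trans e21
  have e32 : σ₃.nat aRow = σ.nat aRow := (ha₃.nat _ (by decide)).trans e22
  have e33 : σ₃.nat aCol = σ.nat aCol := (ha₃.nat _ (by decide)).trans e23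
  have e34 : σ₃.nat aMatch = σ.nat aMatch := (ha₃.nat _ (by decide)).trans e24
  have e35 : σ₃.nat aMinRow = σ₁.nat aMinRow := (ha₃.nat _ (by decide)).trans e25
  have e36 : σ₃.nat aMinCol = σ₁.nat aMinCol := (ha₃.nat _ (by decide)).trans e26
  have e37 : σ₃.nat aFound = σ₁.nat aFound := (ha₃.nat _ (by decide)).trans e27
  have e38 : σ₃.real xRow = σ₂.real xRow := ha₃.real _ (by decide)
  have e39 : σ₃.real xCol = σ₂.real xCol := ha₃.real _ (by decide)
  rw [e21, e24, e26] at ho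
  rw [e2] at hr hU hmin
  rw [e3] at hc hV hmin
  rw [e5] at hδ hU hmin
  rw [e6] at hδ hV hmin
  set r := σ₁.nat aMinRow 0
  set j := σ₁.nat aMinCol 0
  set cur := σ.nat aCur 0
  set δ := σ₁.real xDelta 0
  have hrR : r ∈ {x | x < M ∧ 1 ≤ σ.nat aRow x} := ⟨hrM, hr⟩
  have hjC : j ∉ {x | x < M ∧ 1 ≤ σ.nat aCol x} := fun hh => hc hh.2
  have hmin' : ∀ i ∈ {x | x < M ∧ 1 ≤ σ.nat aRow x}, ∀ k < M,
      k ∉ {x | x < M ∧ 1 ≤ σ.nat aCol x} → F i k →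
      δ ≤ W i k - σ.real xRow i - σ.real xCol k := fun i hi k hk hkC hF =>
    hmin i hi.1 k hk trivial hi.2 (fun hh => hkC ⟨hk, hh⟩) hF
  have hU' : ∀ x < M, (x ∈ {x | x < M ∧ 1 ≤ σ.nat aRow x} → σ₂.real xRow x = σ.real xRow x + δ) ∧
      (x ∉ {x | x < M ∧ 1 ≤ σ.nat aRow x} → σ₂.real xRow x = σ.real xRow x) := fun x hx =>
    ⟨fun hh => (hU x hx).1 hh.2, fun hh => (hU x hx).2 fun h' => hh ⟨hx, h'⟩⟩
  have hV' : ∀ x < M, (x ∈ {x | x < M ∧ 1 ≤ σ.nat aCol x} → σ₂.real xCol x = σ.real xCol x - δ) ∧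
      (x ∉ {x | x < M ∧ 1 ≤ σ.nat aCol x} → σ₂.real xCol x = σ.real xCol x) := fun x hx =>
    ⟨fun hh => (hV x hx).1 hh.2, fun hh => (hV x hx).2 fun h' => hh ⟨hx, h'⟩⟩
  have hrcur : r ≤ cur := hs.row_le r hrR
  -- An owner equal to `r` would be visited, hence matched to a visited column, unlike `j`; the
  -- default owner `cur + 1` exceeds `r`.
  have hne : σ₃.nat aOwn 0 ≠ r := by
    rcases ho with ⟨ho, hm⟩ | ⟨ho, -⟩
    · intro he
      refine hjC ?_
      have := (hs.col_iff cur hs.root _ ho.le ho.ne).2 (he ▸ hrR)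
      rwa [State.matching, hm] at this
    · omega
  rw [wp_seq]
  refine (wp_copyMatching hT₃ (by rcases ho with ho | ho <;> omega) (by rwa [e35])
    (by rwa [e35])).agree.mono fun σ₄ t₄ ⟨⟨hA, hAr, hAx, ht₄⟩, ha₄⟩ => ?_
  have e41 : σ₄.nat aCur = σ.nat aCur := (ha₄.nat _ (by decide)).trans e31
  have e42 : σ₄.nat aRow = σ.nat aRow := (ha₄.nat _ (by decide)).trans e32
  have e43 : σ₄.nat aCol = σ.nat aCol := (ha₄.nat _ (by decide)).trans e33
  have e44 : σ₄.nat aOwn = σ₃.nat aOwn := ha₄.nat _ (by decide)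
  have e46 : σ₄.nat aMinCol = σ₁.nat aMinCol := (ha₄.nat _ (by decide)).trans e36
  have e47 : σ₄.nat aFound = σ₁.nat aFound := (ha₄.nat _ (by decide)).trans e37
  have e48 : σ₄.real xRow = σ₂.real xRow := (ha₄.real _ (by decide)).trans e38
  have e49 : σ₄.real xCol = σ₂.real xCol := (ha₄.real _ (by decide)).trans e39
  rw [e34] at hA hAx
  rw [e35] at hAr hAx
  rw [e36] at hAr
  rw [visit, wp_seq, wp_setNat, wp_setNat]
  have ht : t₁ + ((Test.set (.get aFound)).cost + (t₂ + (t₃ + (t₄ +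
      (((NatExp.get aOwn).cost + (NatExp.const 1).cost + 1) +
        ((NatExp.get aMinCol).cost + (NatExp.const 1).cost + 1) + 1) + 1) + 1) + 1) + 1) + 1
      ≤ 500 * M ^ 2 := by
    simp only [Test.cost, NatExp.cost]
    nlinarith
  rw [← and_assoc]
  refine ⟨?_, ht⟩
  set τ : State := ⟨write (write σ₄.nat aRow (σ₄.nat aOwn 0) 1) aCol (σ₄.nat aMinCol 0) 1, σ₄.real⟩
    with hτ
  change SearchResult M F W τ ∧ τ.searchVariant < σ.searchVariant
  have f1 : τ.nat aCur = σ.nat aCur := by simp [hτ, e41]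
  have f2 : ∀ x, τ.nat aRow x = if x = σ₃.nat aOwn 0 then 1 else σ.nat aRow x := by
    simp [hτ, e44, e42]
  have f3 : ∀ x, τ.nat aCol x = if x = j then 1 else σ.nat aCol x := by
    simp [hτ, e46, e43, j]
  have f4 : τ.nat aOwn = σ₃.nat aOwn := by simp [hτ, e44]
  have f5 : τ.nat aFound 0 = 1 := by simp [hτ, e47, hf₁]
  have f6 : τ.nat aMatch = σ₄.nat aMatch := by simp [hτ]
  have f7 : τ.real xRow = σ₂.real xRow := e48
  have f8 : τ.real xCol = σ₂.real xCol := e49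
  rcases ho with ⟨ho, hm⟩ | ⟨ho, hfree⟩
  · obtain ⟨hoR, hs'⟩ := hs.step (A' := τ.matching M) hrR hcM hjC hrc hδ hmin' hU' hV' ho hm
      (fun i _ hio x hx => by rw [State.matching, f6, hA i hio x (hx.trans_lt hcur)])
      (by rw [State.matching, f6, hAr])
      (fun x hx hxr => by rw [State.matching, f6, hAx x (hx.trans_lt hcur) hxr])
    have hoM : σ₃.nat aOwn 0 < M := ho.trans hcur
    refine ⟨.running f5 (by rw [f4, f1]; exact ho.le) ?_, ?_⟩
    · rw [SearchAt, f1, f7, f8]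
      convert hs' using 1
      · ext x
        simp only [Set.mem_ofPred_eq, f2, Set.mem_insert_iff]
        split_ifs with hx <;> simp [hx, hoM]
      · ext x
        simp only [Set.mem_ofPred_eq, f3, Set.mem_insert_iff]
        split_ifs with hx <;> simp [hx, hcM]
    · rw [hpos, State.searchVariant, if_pos ⟨by rw [f4, f1]; exact ho.le, f5.ge⟩, f1]
      refine Nat.add_lt_add_right (Finset.card_lt_card ?_) 1
      rw [Finset.ssubset_iff_of_subset]
      · refine ⟨σ₃.nat aOwn 0, ?_, by simp [f2]⟩
        simp only [Finset.mem_filter, Finset.mem_range]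
        refine ⟨by omega, ?_⟩
        by_contra h0
        exact hoR ⟨hoM, Nat.one_le_iff_ne_zero.2 h0⟩
      · intro x
        simp only [Finset.mem_filter, f2]
        split_ifs <;> simp [cur]
  · refine ⟨.done f5 (by rw [f4, f1, ho]) ⟨?_, ?_⟩, ?_⟩
    · rw [f7, f8]
      exact hs.dual_update hrR hcM hrc hδ hmin' hU' hV'
    · rw [f7, f8, f1]
      refine hs.finish hrR hcM hjC hrc hδ hU' hV' hfree ?_ fun x hx hxr => ?_
      -- The owner is `cur + 1`, so the copied row is the one in which `MatchingAt` expects the new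
      -- matching.
      · rw [State.matching, f6, ← ho, hAr]
      · rw [State.matching, f6, ← ho, hAx x (hx.trans_lt hcur) hxr]
    · rw [hpos, State.searchVariant, if_neg (by rw [f4, f1, ho]; simp [cur])]
      omega

end RAM

/-! ### Row insertion and the complete Hungarian method -/

namespace RAM

open Code Assignment

variable {O : ℕ → Finset ℕ → Option ℝ} {M : ℕ} {F : ℕ → ℕ → Prop} {W : ℕ → ℕ → ℝ} {σ τ : State}

theorem wp_reset (hM : σ.nat aIn 0 = M) :
    Wp O reset σ fun τ t =>
      (∀ x < M, τ.nat aRow x = if x = σ.nat aCur 0 then 1 else 0) ∧ (∀ x < M, τ.nat aCol x = 0) ∧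
      τ.nat aOwn 0 = σ.nat aCur 0 ∧ t ≤ M * 50 + 40 := by
  rw [reset, wp_seq]
  refine (wp_forLoop M 20 (fun k σ' => ∀ x < k, σ'.nat aRow x = 0 ∧ σ'.nat aCol x = 0)
    (by decide) ?_ ?_ ?_).mono ?_
  · intro σ' ha
    simp [ha.nat 0 (by decide), hM]
  · simp
  · intro k hk σ' ha hI hInv
    simp only [resetOne, wp_seq, wp_setNat]
    simp only [NatExp.eval, NatExp.cost, hI, write_self, write_of_ne, ne_eq, Nat.reduceEqDiff,
      not_false_iff]
    refine ⟨fun x hx => ?_, by norm_num⟩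
    by_cases hxk : x = k
    · simp [hxk]
    · simpa [hxk] using hInv x (by omega)
  · rintro τ t ⟨hInv, ht, ha⟩
    have h1 : τ.nat aCur = σ.nat aCur := ha.nat _ (by decide)
    simp only [wp_seq, wp_setNat]
    simp only [NatExp.eval, NatExp.cost, h1, write_self, write_of_ne, ne_eq, Nat.reduceEqDiff,
      not_false_iff, if_true, true_and] at ht ⊢
    refine ⟨fun x hx => ?_, fun x hx => (hInv x hx).2, by omega⟩
    rw [(hInv x hx).1]

/-- The variant starts at no more than `M + 1`, so there are at most `M + 1` search steps of O(M²)
each. -/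
theorem wp_insertRow (h : Table M F W σ) (hcur : σ.nat aCur 0 < M) (hf : σ.nat aFound 0 = 1)
    (hm : MatchingAt M F W (σ.nat aCur 0) σ) :
    Wp O insertRow σ fun τ t =>
      (τ.nat aFound 0 = 1 ∧ τ.nat aCur 0 = σ.nat aCur 0 + 1 ∧ MatchingAt M F W (τ.nat aCur 0) τ ∨
        τ.nat aFound 0 = 0 ∧ NoMatching M F) ∧ t ≤ 2000 * M ^ 3 := by
  have hM1 : 1 ≤ M := by omega
  rw [insertRow, wp_seq]
  refine (wp_reset h.users).agree.mono fun σ₁ t₁ ⟨⟨hR, hC, ho, ht₁⟩, ha₁⟩ => ?_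
  have hT₁ := h.of_agree ha₁ (by decide) (by decide)
  have e1 : σ₁.nat aCur = σ.nat aCur := ha₁.nat _ (by decide)
  have e2 : σ₁.nat aMatch = σ.nat aMatch := ha₁.nat _ (by decide)
  have e3 : σ₁.nat aFound = σ.nat aFound := ha₁.nat _ (by decide)
  have e4 : σ₁.real xRow = σ.real xRow := ha₁.real _ (by decide)
  have e5 : σ₁.real xCol = σ.real xCol := ha₁.real _ (by decide)
  have hs : SearchAt M F W σ₁ := by
    rw [SearchAt, e1, e4, e5]
    convert Search.start hcur hm.dual (A := σ₁.matching M) ?_ using 1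
    · ext x
      simp only [Set.mem_ofPred_eq, Set.mem_singleton_iff]
      constructor
      · rintro ⟨hx, h1⟩
        by_contra hne
        rw [hR x hx, if_neg hne] at h1
        omega
      · rintro rfl
        exact ⟨hcur, by rw [hR _ hcur, if_pos rfl]⟩
    · ext x
      simp only [Set.mem_ofPred_eq, Set.mem_empty_iff_false, iff_false, not_and]
      intro hx
      rw [hC x hx]
      omega
    · refine hm.matching.congr fun x _ => ?_
      rw [State.matching, e2]
  have hvar : σ₁.searchVariant ≤ M + 1 := by
    unfold State.searchVariant
    split_ifs
    · have := Finset.card_filter_le (Finset.range (σ₁.nat aCur 0 + 1)) fun x => σ₁.nat aRow x = 0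
      rw [Finset.card_range, e1] at this
      rw [e1]
      omega
    · omega
  rw [wp_seq]
  refine (wp_loop_variant (SearchResult M F W) State.searchVariant (500 * M ^ 2)
    (.running (by rw [e3, hf]) (by rw [ho, e1]) hs) ?_).mono ?_
  · intro σ' ha hres hb
    have hT' := hT₁.of_agree ha (by decide) (by decide)
    simp only [Test.Holds, NatExp.eval] at hb
    cases hres with
    | running h1 h2 h3 => exact wp_searchStep hT' h3 h2 h1
    | done h1 h2 h3 => omega
    | stuck h1 h2 => omega
  · rintro σ₂ t₂ ⟨hres, hb, ht₂, ha₂⟩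
    have e21 : σ₂.nat aCur = σ.nat aCur := (ha₂.nat _ (by decide)).trans e1
    simp only [Test.Holds, NatExp.eval] at hb
    simp only [wp_setNat]
    simp only [NatExp.eval, NatExp.cost, Test.cost, write_self, write_of_ne, ne_eq, Nat.reduceEqDiff,
      not_false_iff, if_true] at ht₂ ⊢
    refine ⟨?_, ?_⟩
    · cases hres with
      | running h1 h2 h3 => omega
      | done h1 h2 h3 =>
        refine Or.inl ⟨h1, by rw [h1, e21], ?_⟩
        rw [h1]
        exact ⟨h3.dual, h3.matching⟩
      | stuck h1 h2 => exact Or.inr ⟨h1, h2⟩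
    · have h1 : σ₁.searchVariant * (500 * M ^ 2 + (2 + 2 + 1 + (1 + 2 + 1) + 1) + 1) ≤
          (M + 1) * (500 * M ^ 2 + (2 + 2 + 1 + (1 + 2 + 1) + 1) + 1) := Nat.mul_le_mul_right _ hvar
      have h2 : M ≤ M ^ 2 := by nlinarith
      have h3 : M ^ 2 ≤ M ^ 3 := Nat.pow_le_pow_right hM1 (by norm_num)
      ring_nf at h1 ht₂ ⊢
      omega

/-- The Hungarian method finds an optimal assignment or reports that there is none. -/
theorem wp_assign (hM : 1 ≤ M) (h : Table M F W σ) (hW : ∀ i < M, ∀ j < M, F i j → 0 ≤ W i j) :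
    Wp O assign σ fun τ t =>
      (τ.nat aFound 0 = 1 ∧ MatchingAt M F W M τ ∨ τ.nat aFound 0 = 0 ∧ NoMatching M F) ∧
      t ≤ 3000 * M ^ 4 := by
  rw [assign, wp_seq]
  refine (wp_forLoop M 20 (fun k σ' => ∀ x < k, σ'.real xRow x = 0 ∧ σ'.real xCol x = 0)
    (by decide) ?_ ?_ ?_).mono ?_
  · intro σ' ha
    simp [ha.nat 0 (by decide), h.users]
  · simp
  · intro k hk σ' ha hI hInv
    simp only [clearOne, wp_seq, wp_setReal]
    simp only [NatExp.eval, RealExp.eval, NatExp.cost, RealExp.cost, hI, write_self, write_of_ne,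
      ne_eq, Nat.reduceEqDiff, not_false_iff]
    refine ⟨fun x hx => ?_, by norm_num⟩
    by_cases hxk : x = k
    · simp [hxk]
    · simpa [hxk] using hInv x (by omega)
  · rintro σ₁ t₁ ⟨hInv, ht₁, ha₁⟩
    have hT₁ := h.of_agree ha₁ (by decide) (by decide)
    simp only [wp_seq, wp_setNat]
    simp only [NatExp.eval, NatExp.cost] at ht₁ ⊢
    set σ₂ : State := ⟨write (write σ₁.nat aCur 0 0) aFound 0 1, σ₁.real⟩ with hσ₂
    have hT₂ : Table M F W σ₂ := hT₁.of_eq (by simp [hσ₂]) (by simp [hσ₂]) (by simp [hσ₂]) rfl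
    have hc₂ : σ₂.nat aCur 0 = 0 := by simp [hσ₂]
    have hf₂ : σ₂.nat aFound 0 = 1 := by simp [hσ₂]
    refine (wp_loop_variant
      (fun σ' => σ'.nat aFound 0 = 1 ∧ σ'.nat aCur 0 ≤ M ∧ MatchingAt M F W (σ'.nat aCur 0) σ' ∨
        σ'.nat aFound 0 = 0 ∧ NoMatching M F)
      -- A successful insertion lowers the second factor, a failed one makes the first factor zero.
      (fun σ' => σ'.nat aFound 0 * (M - σ'.nat aCur 0)) (2000 * M ^ 3) ?_ ?_).mono ?_
    -- Zero potentials are admissible because the costs are nonnegative.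
    · refine Or.inl ⟨hf₂, by omega, ⟨fun i hi j hj hF => ?_, ?_⟩⟩
      · have h1 : σ₂.real xRow i = 0 := (hInv i hi).1
        have h2 : σ₂.real xCol j = 0 := (hInv j hj).2
        rw [h1, h2, add_zero]
        exact hW i hi j hj hF
      · rw [hc₂]
        constructor <;> simp
    · intro σ' ha hI hb
      have hT' := hT₂.of_agree ha (by decide) (by decide)
      simp only [Test.Holds, NatExp.eval, hT'.users, not_le] at hb
      rcases hI with ⟨h1, h2, h3⟩ | ⟨h1, -⟩
      · refine (wp_insertRow hT' hb.1 h1 h3).mono fun τ t ⟨hres, ht⟩ => ⟨?_, ?_, ht⟩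
        · exact hres.imp_left fun ⟨r1, r2, r3⟩ => ⟨r1, by omega, r3⟩
        · rcases hres with ⟨r1, r2, -⟩ | ⟨r1, -⟩
          · rw [r1, r2, h1]; omega
          · rw [r1, h1]; omega
      · omega
    · rintro τ t ⟨hI, hb, ht, ha⟩
      have hT' := hT₂.of_agree ha (by decide) (by decide)
      simp only [Test.Holds, NatExp.eval, hT'.users, not_and, not_le] at hb
      refine ⟨?_, ?_⟩
      · rcases hI with ⟨h1, h2, h3⟩ | hI
        · have : τ.nat aCur 0 = M := by
            by_contra hne
            have := hb (by omega)
            omega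
          rw [this] at h3
          exact Or.inl ⟨h1, h3⟩
        · exact Or.inr hI
      · simp only [hc₂, hf₂, Test.cost, NatExp.cost, Nat.sub_zero, one_mul] at ht
        have h1 : M ≤ M ^ 4 := Nat.le_self_pow (by norm_num) M
        have h2 : 1 ≤ M ^ 4 := Nat.one_le_pow _ _ hM
        ring_nf at ht ht₁ ⊢
        omega

end RAM

/-! ### Cost matrix, total power and output for one block -/

namespace RAM

open Code Assignment

variable {O : ℕ → Finset ℕ → Option ℝ} {M : ℕ} {F : ℕ → ℕ → Prop} {W : ℕ → ℕ → ℝ} {σ τ : State}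

/-- The channels of the user with order `v` in the current block. -/
def State.channels (M : ℕ) (σ : State) (v : ℕ) : Finset ℕ :=
  (Finset.range (σ.nat aC 0)).image fun k => σ.nat aQ 0 + k * (M + σ.nat aS 0) + v

theorem wp_listChannels (hM : σ.nat aIn 0 = M) :
    Wp O listChannels σ fun τ t =>
      τ.listed aList (σ.nat aC 0) = σ.channels M (σ.nat aJ 0) ∧ t ≤ 50 * σ.nat aC 0 + 30 := by
  rw [listChannels, wp_seq, wp_setNat]
  refine (wp_forLoop (σ.nat aC 0) 20 (fun k σ' =>
      (∀ x < k, σ'.nat aList x = σ.nat aQ 0 + x * (M + σ.nat aS 0) + σ.nat aJ 0) ∧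
      σ'.nat aPtr 0 = σ.nat aQ 0 + k * (M + σ.nat aS 0) + σ.nat aJ 0)
    (by decide) ?_ ?_ ?_).mono ?_
  · intro σ' ha
    simp [ha.nat aC (by decide)]
  · simp
  · rintro k hk σ' ha hK ⟨h1, h2⟩
    have e1 : σ'.nat aIn = σ.nat aIn := by simp [ha.nat aIn (by decide)]
    have e2 : σ'.nat aS = σ.nat aS := by simp [ha.nat aS (by decide)]
    simp only [listOne, wp_seq, wp_setNat]
    simp only [NatExp.eval, NatExp.cost, hK, e1, e2, hM, h2, write_self, write_of_ne, ne_eq,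
      Nat.reduceEqDiff, not_false_iff, if_true]
    refine ⟨⟨fun x hx => ?_, by ring⟩, by norm_num⟩
    by_cases hxk : x = k
    · simp [hxk]
    · simpa [hxk] using h1 x (by omega)
  · rintro τ t ⟨⟨h1, -⟩, ht, -⟩
    refine ⟨?_, ?_⟩
    · exact Finset.image_congr fun x hx => h1 x (by simpa using hx)
    · simp only [NatExp.cost] at ht ⊢
      omega

/-- The entry `(i, j)` of the cost matrix holds the answer `o`. -/
def EntryAt (M i j : ℕ) (o : Option ℝ) (σ : State) : Prop :=
  (1 ≤ σ.nat aFlag (i * M + j) ↔ o.isSome) ∧ σ.real xCost (i * M + j) = o.getD 0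

theorem wp_fillEntry (hM : σ.nat aIn 0 = M) (hoff : σ.nat aOff (σ.nat aI 0) = σ.nat aI 0 * M)
    (hj : σ.nat aJ 0 < M) :
    Wp O fillEntry σ fun τ t =>
      EntryAt M (σ.nat aI 0) (σ.nat aJ 0) (O (σ.nat aI 0) (σ.channels M (σ.nat aJ 0))) τ ∧
      (∀ i j o, j < M → ¬ (i = σ.nat aI 0 ∧ j = σ.nat aJ 0) → EntryAt M i j o σ →
        EntryAt M i j o τ) ∧ t ≤ 60 * σ.nat aC 0 + 60 := by
  rw [fillEntry, wp_seq]
  refine (wp_listChannels hM).agree.mono fun σ₁ t₁ ⟨⟨hl, ht₁⟩, ha⟩ => ?_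
  have e1 : σ₁.nat aI = σ.nat aI := ha.nat _ (by decide)
  have e2 : σ₁.nat aJ = σ.nat aJ := ha.nat _ (by decide)
  have e3 : σ₁.nat aC = σ.nat aC := ha.nat _ (by decide)
  have e4 : σ₁.nat aOff = σ.nat aOff := ha.nat _ (by decide)
  have e5 : σ₁.nat aFlag = σ.nat aFlag := ha.nat _ (by decide)
  have e6 : σ₁.real xCost = σ.real xCost := ha.real _ (by decide)
  simp only [wp_seq, wp_call, wp_setReal, wp_setNat]
  simp only [State.answer, EntryAt, NatExp.eval, NatExp.cost, RealExp.eval, RealExp.cost, e1, e2,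
    e3, e4, e5, e6, hoff, hl, write_self, write_of_ne, ne_eq, Nat.reduceEqDiff, not_false_iff,
    if_true]
  refine ⟨⟨?_, trivial⟩, fun i j o hjM hne ho => ?_, by omega⟩
  · split_ifs with h <;> simp [h]
  · have : ¬ i * M + j = σ.nat aI 0 * M + σ.nat aJ 0 := by rwa [mul_add_inj hjM hj]
    simpa only [this, if_false] using ho

theorem wp_fillRow (hM : σ.nat aIn 0 = M)
    (hoff : ∀ i ≤ σ.nat aI 0, σ.nat aOff i = i * M)
    (he : ∀ i < σ.nat aI 0, ∀ j < M, EntryAt M i j (O i (σ.channels M j)) σ) :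
    Wp O fillRow σ fun τ t =>
      (∀ i ≤ σ.nat aI 0 + 1, τ.nat aOff i = i * M) ∧
      (∀ i < σ.nat aI 0 + 1, ∀ j < M, EntryAt M i j (O i (σ.channels M j)) τ) ∧
      t ≤ M * (60 * σ.nat aC 0 + 80) + 30 := by
  rw [fillRow, wp_seq]
  refine (wp_forLoop M (60 * σ.nat aC 0 + 60) (fun k σ' =>
      ∀ i j, j < M → (i < σ.nat aI 0 ∨ i = σ.nat aI 0 ∧ j < k) →
        EntryAt M i j (O i (σ.channels M j)) σ')
    (by decide) ?_ ?_ ?_).mono ?_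
  · intro σ' ha
    simp [ha.nat aIn (by decide), hM]
  · intro i j hj hij
    have := he i (by omega) j hj
    simpa [EntryAt] using this
  · intro k hk σ' ha hJ hInv
    have e0 : σ'.nat aIn = σ.nat aIn := ha.nat _ (by decide)
    have e1 : σ'.nat aI = σ.nat aI := ha.nat _ (by decide)
    have e2 : σ'.nat aOff = σ.nat aOff := ha.nat _ (by decide)
    have e3 : σ'.nat aC = σ.nat aC := ha.nat _ (by decide)
    have e4 : σ'.nat aS = σ.nat aS := ha.nat _ (by decide)
    have e5 : σ'.nat aQ = σ.nat aQ := ha.nat _ (by decide)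
    have ec : σ'.channels M = σ.channels M := by
      funext v; simp only [State.channels, e3, e4, e5]
    refine (wp_fillEntry (M := M) (by rw [e0, hM]) (by rw [e1, e2]; exact hoff _ le_rfl)
      (by rwa [hJ])).mono fun τ t ⟨h1, h2, ht⟩ => ⟨fun i j hj hij => ?_, by rwa [e3] at ht⟩
    rw [e1, hJ] at h1 h2
    rw [ec] at h1
    suffices EntryAt M i j (O i (σ.channels M j)) τ by simpa [EntryAt] using this
    by_cases hc : i = σ.nat aI 0 ∧ j = k
    · rw [hc.1, hc.2]; exact h1
    · exact h2 i j _ hj hc (hInv i j hj (by omega))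
  · rintro τ t ⟨hInv, ht, ha⟩
    have e0 : τ.nat aIn = σ.nat aIn := ha.nat _ (by decide)
    have e1 : τ.nat aI = σ.nat aI := ha.nat _ (by decide)
    have e2 : τ.nat aOff = σ.nat aOff := ha.nat _ (by decide)
    simp only [wp_setNat]
    simp only [EntryAt, NatExp.eval, NatExp.cost, e0, e1, e2, hM, write_self, write_of_ne, ne_eq,
      Nat.reduceEqDiff, not_false_iff] at ht hInv ⊢
    refine ⟨fun i hi => ?_, fun i hi j hj => hInv i j hj (by omega), ?_⟩
    · split_ifs with h
      · rw [h, hoff _ le_rfl]; ring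
      · exact hoff i (by omega)
    · ring_nf at ht ⊢
      omega

/-- Listing `c` channels and calling the routine costs O(c) for each of the M² entries. -/
theorem wp_fill (hM : σ.nat aIn 0 = M) :
    Wp O fill σ fun τ t =>
      Table M (fun i j => (O i (σ.channels M j)).isSome) (fun i j => (O i (σ.channels M j)).getD 0) τ ∧
      t ≤ M * (M * (60 * σ.nat aC 0 + 80) + 50) + 30 := by
  rw [fill, wp_seq, wp_setNat]
  refine (wp_forLoop M (M * (60 * σ.nat aC 0 + 80) + 30) (fun k σ' =>
      (∀ i ≤ k, σ'.nat aOff i = i * M) ∧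
      (∀ i < k, ∀ j < M, EntryAt M i j (O i (σ.channels M j)) σ'))
    (by decide) ?_ ?_ ?_).mono ?_
  · intro σ' ha
    simp [ha.nat aIn (by decide), hM]
  · simp
  · rintro k hk σ' ha hI ⟨hoff, he⟩
    have e0 : σ'.nat aIn = σ.nat aIn := by simp [ha.nat aIn (by decide)]
    have e3 : σ'.nat aC = σ.nat aC := by simp [ha.nat aC (by decide)]
    have e4 : σ'.nat aS = σ.nat aS := by simp [ha.nat aS (by decide)]
    have e5 : σ'.nat aQ = σ.nat aQ := by simp [ha.nat aQ (by decide)]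
    have ec : σ'.channels M = σ.channels M := by
      funext v; simp only [State.channels, e3, e4, e5]
    refine (wp_fillRow (M := M) (by rw [e0, hM]) (by rwa [hI]) (by rwa [hI, ec])).mono
      fun τ t ⟨h1, h2, ht⟩ => ?_
    rw [hI] at h1 h2
    rw [ec] at h2
    rw [e3] at ht
    simp only [EntryAt, write_of_ne, ne_eq, Nat.reduceEqDiff, not_false_iff] at h2 ⊢
    exact ⟨⟨h1, h2⟩, ht⟩
  · rintro τ t ⟨⟨hoff, he⟩, ht, ha⟩
    refine ⟨⟨by simp [ha.nat aIn (by decide), hM], hoff, fun i hi j hj => (he i hi j hj).1,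
      fun i hi j hj => (he i hi j hj).2⟩, ?_⟩
    simp only [NatExp.cost] at ht ⊢
    ring_nf at ht ⊢
    omega

theorem wp_sumUp (h : Table M F W σ) (hm : ∀ x < M, σ.matching M M x < M) :
    Wp O sumUp σ fun τ t =>
      τ.real xSum 0 = ∑ x ∈ Finset.range M, W x (σ.matching M M x) ∧ t ≤ M * 50 + 30 := by
  rw [sumUp, wp_seq, wp_setReal]
  refine (wp_forLoop M 30 (fun k σ' =>
      σ'.real xSum 0 = ∑ x ∈ Finset.range k, W x (σ.matching M M x))
    (by decide) ?_ ?_ ?_).mono ?_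
  · intro σ' ha
    simp [ha.nat aIn (by decide), h.users]
  · simp
  · rintro k hk σ' ha hI hInv
    have e1 : σ'.nat aIn = σ.nat aIn := ha.nat _ (by decide)
    have e2 : σ'.nat aOff = σ.nat aOff := ha.nat _ (by decide)
    have e3 : σ'.nat aMatch = σ.nat aMatch := ha.nat _ (by decide)
    have e4 : σ'.real xCost = σ.real xCost := by simp [ha.real xCost (by decide)]
    simp only [sumOne, wp_setReal]
    simp only [NatExp.eval, RealExp.eval, NatExp.cost, RealExp.cost, hI, e1, e2, e3, e4, h.users,
      h.off M le_rfl, h.off k hk.le, write_self, if_true, hInv]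
    refine ⟨?_, by norm_num⟩
    rw [Finset.sum_range_succ, h.cost k hk _ (hm k hk)]
  · rintro τ t ⟨hInv, ht, -⟩
    refine ⟨hInv, ?_⟩
    simp only [NatExp.cost, RealExp.cost] at ht ⊢
    omega

theorem wp_total :
    Wp O total σ fun τ t =>
      τ.real xTotal 0 = σ.nat aC 0 * σ.real xSum 0 ∧ t ≤ σ.nat aC 0 * 50 + 30 := by
  rw [total, wp_seq, wp_setReal]
  refine (wp_forLoop (σ.nat aC 0) 30 (fun k σ' => σ'.real xTotal 0 = k * σ.real xSum 0)
    (by decide) ?_ ?_ ?_).mono ?_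
  · intro σ' ha
    simp [ha.nat aC (by decide)]
  · simp
  · rintro k hk σ' ha hI hInv
    have e4 : σ'.real xSum = σ.real xSum := by simp [ha.real xSum (by decide)]
    simp only [totalOne, wp_setReal]
    simp only [NatExp.eval, RealExp.eval, NatExp.cost, RealExp.cost, e4, write_self, if_true, hInv]
    refine ⟨?_, by norm_num⟩
    push_cast
    ring
  · rintro τ t ⟨hInv, ht, -⟩
    refine ⟨hInv, ?_⟩
    simp only [NatExp.cost, RealExp.cost] at ht ⊢
    omega

theorem wp_record (h : Table M F W σ) (hm : ∀ x < M, σ.matching M M x < M) :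
    Wp O record σ fun τ t =>
      (τ.nat aOut 0 = 1 ∧ τ.nat aOut 1 = σ.nat aC 0 ∧ τ.nat aOut 2 = σ.nat aS 0 ∧
        τ.nat aOut 3 = σ.nat aQ 0 ∧ (∀ x < M, τ.nat aOrder x = σ.matching M M x) ∧
        (∀ x < M, τ.real xPower x = W x (σ.matching M M x)) ∧
        τ.real xBest 0 = σ.real xTotal 0) ∧ t ≤ M * 60 + 60 := by
  rw [record, wp_seq]
  refine (wp_forLoop M 40 (fun k σ' =>
      (∀ x < k, σ'.nat aOrder x = σ.matching M M x) ∧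
      (∀ x < k, σ'.real xPower x = W x (σ.matching M M x)))
    (by decide) ?_ ?_ ?_).mono ?_
  · intro σ' ha
    simp [ha.nat aIn (by decide), h.users]
  · simp
  · rintro k hk σ' ha hI ⟨h1, h2⟩
    have e1 : σ'.nat aIn = σ.nat aIn := ha.nat _ (by decide)
    have e2 : σ'.nat aOff = σ.nat aOff := ha.nat _ (by decide)
    have e3 : σ'.nat aMatch = σ.nat aMatch := ha.nat _ (by decide)
    have e4 : σ'.real xCost = σ.real xCost := ha.real _ (by decide)
    simp only [recordOne, wp_seq, wp_setNat, wp_setReal]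
    simp only [NatExp.eval, RealExp.eval, NatExp.cost, RealExp.cost, hI, e1, e2, e3, e4, h.users,
      h.off M le_rfl, h.off k hk.le, write_self, write_of_ne, ne_eq, Nat.reduceEqDiff,
      not_false_iff, h.cost k hk _ (hm k hk)]
    refine ⟨⟨fun x hx => ?_, fun x hx => ?_⟩, by norm_num⟩
    · by_cases hxk : x = k
      · simp [hxk]
      · simpa [hxk] using h1 x (by omega)
    · by_cases hxk : x = k
      · simp [hxk]
      · simpa [hxk] using h2 x (by omega)
  · rintro τ t ⟨⟨h1, h2⟩, ht, ha⟩
    have e1 : τ.nat aC = σ.nat aC := ha.nat _ (by decide)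
    have e2 : τ.nat aS = σ.nat aS := ha.nat _ (by decide)
    have e3 : τ.nat aQ = σ.nat aQ := ha.nat _ (by decide)
    have e4 : τ.real xTotal = σ.real xTotal := ha.real _ (by decide)
    simp only [block, wp_seq, wp_setNat, wp_setReal]
    simp only [NatExp.eval, RealExp.eval, NatExp.cost, RealExp.cost, e1, e2, e3, e4, write_self,
      write_of_ne, ne_eq, Nat.reduceEqDiff, not_false_iff, if_true, if_false, true_and] at ht ⊢
    exact ⟨⟨h1, h2, trivial⟩, by omega⟩

end RAM

/-! ## Allocations and assignments -/

namespace IFDMA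

variable {M N : ℕ}

/-- A block has length `c * M + s * (c - 1)`, so the floor bounds on `c` and `s` only say that the
block fits into `N` channels. This form has no division and matches the loop tests. -/
theorem Block.isValid_iff (hM : 1 ≤ M) {b : Block} :
    b.IsValid M N ↔ 1 ≤ b.c ∧ (b.c = 1 → b.s = 0) ∧ b.q + b.length M ≤ N := by
  obtain ⟨c, s, q⟩ := b
  simp only [Block.IsValid, Block.length, Nat.le_div_iff_mul_le hM]
  rcases c with - | c
  · simp
  simp only [Nat.add_sub_cancel]
  have hL : c * (M + s) + M = (c + 1) * M + s * c := by ring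
  constructor
  · rintro ⟨h1, h2, h3, h4, h5⟩
    refine ⟨h1, h3, ?_⟩
    have h6 : s * c ≤ N - (c + 1) * M := by
      rcases Nat.eq_zero_or_pos c with rfl | hc
      · simp
      · exact (Nat.le_div_iff_mul_le hc).1 (h4 (by omega))
    omega
  · rintro ⟨h1, h3, h5⟩
    refine ⟨h1, by omega, h3, fun h2 => ?_, by omega⟩
    rw [Nat.le_div_iff_mul_le (by omega)]
    omega

/-- Each of `c`, `s`, `q` is at most `N`, so the cube alone suffices and the summand `N + 1` is
slack. -/
theorem Block.encard_isValid_le (hM : 1 ≤ M) :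
    {b : Block | b.IsValid M N}.encard ≤ (((N + 1) + (N + 1) ^ 3 : ℕ) : ℕ∞) := by
  let f : Block → ℕ × ℕ × ℕ := fun b => (b.c, b.s, b.q)
  have hf : Function.Injective f := by
    rintro ⟨c, s, q⟩ ⟨c', s', q'⟩ h
    simpa [f] using h
  let T : Finset (ℕ × ℕ × ℕ) :=
    Finset.range (N + 1) ×ˢ Finset.range (N + 1) ×ˢ Finset.range (N + 1)
  have hsub : f '' {b : Block | b.IsValid M N} ⊆ T := by
    rintro _ ⟨b, hb, rfl⟩
    obtain ⟨h1, h2, h3⟩ := (Block.isValid_iff hM).1 hb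
    have hc : b.c - 1 ≤ (b.c - 1) * (M + b.s) := Nat.le_mul_of_pos_right _ (by omega)
    have hs : b.s ≤ (b.c - 1) * (M + b.s) := by
      rcases h1.eq_or_lt with h | h
      · rw [h2 h.symm]; exact Nat.zero_le _
      · exact le_trans (by omega) (Nat.le_mul_of_pos_left _ (by omega))
    rw [Block.length] at h3
    simp only [T, f, Finset.coe_product, Finset.coe_range, Set.mem_prod, Set.mem_Iio]
    omega
  calc {b : Block | b.IsValid M N}.encard = (f '' {b : Block | b.IsValid M N}).encard :=
        (hf.encard_image _).symm
    _ ≤ (T : Set (ℕ × ℕ × ℕ)).encard := Set.encard_le_encard hsub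
    _ = (((N + 1) ^ 3 : ℕ) : ℕ∞) := by
        rw [Set.encard_coe_eq_coe_finsetCard, Finset.card_product, Finset.card_product,
          Finset.card_range]
        congr 1; ring
    _ ≤ _ := by exact_mod_cast Nat.le_add_left _ _

theorem Block.card_channels (hM : 1 ≤ M) {b : Block} (hb : b.IsValid M N) (v : Fin M) :
    (b.channels M N v).card = b.c := by
  obtain ⟨h1, -, h3⟩ := (Block.isValid_iff hM).1 hb
  have hlt : ∀ k < b.c, b.q + k * (M + b.s) + v < N := fun k hk => by
    have : k * (M + b.s) ≤ (b.c - 1) * (M + b.s) := Nat.mul_le_mul_right _ (by omega)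
    have := v.2
    rw [Block.length] at h3
    omega
  let f : Fin b.c → Fin N := fun k => ⟨b.q + k * (M + b.s) + v, hlt k k.2⟩
  have hf : Function.Injective f := by
    intro k k' h
    have : (k : ℕ) * (M + b.s) = k' * (M + b.s) := by
      have := congrArg Fin.val h
      simp only [f] at this
      omega
    exact Fin.ext (Nat.eq_of_mul_eq_mul_right (by omega) this)
  have : b.channels M N v = Finset.univ.image f := by
    ext j
    simp only [Block.channels, Finset.mem_filter, Finset.mem_univ, true_and, Finset.mem_image, f]
    constructor
    · rintro ⟨k, hk, hj⟩
      exact ⟨⟨k, hk⟩, Fin.ext hj.symm⟩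
    · rintro ⟨k, rfl⟩
      exact ⟨k, k.2, rfl⟩
  rw [this, Finset.card_image_of_injective _ hf, Finset.card_univ, Fintype.card_fin]

/-- Since the factor `c` is common to all users, minimising within a block means minimising a sum of
matrix entries. -/
theorem Allocation.totalPower_eq (hM : 1 ≤ M) {a : Allocation M} (ha : a.block.IsValid M N) :
    a.totalPower N = a.block.c * ∑ i, a.power i := by
  simp only [Allocation.totalPower, Finset.sum_const, Block.card_channels hM ha, nsmul_eq_mul,
    Finset.mul_sum]

/-- The channels of `Block.channels` as natural numbers. -/
def Block.natChannels (b : Block) (M v : ℕ) : Finset ℕ :=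
  (Finset.range b.c).image fun k => b.q + k * (M + b.s) + v

theorem Block.filter_mem_natChannels (b : Block) (v : Fin M) :
    ({j : Fin N | (j : ℕ) ∈ b.natChannels M v} : Finset (Fin N)) = b.channels M N v := by
  ext j
  simp [Block.natChannels, Block.channels, eq_comm]

namespace Instance

variable (I : Instance M N)

theorem isLeast_of_minPower_isSome {b : Block} {i v : Fin M}
    (h : (I.minPower i (b.natChannels M v)).isSome) :
    IsLeast (I.admissible i (b.channels M N v)) ((I.minPower i (b.natChannels M v)).getD 0) := by
  unfold minPower at h ⊢
  split_ifs at h ⊢ with hex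
  · rw [← Block.filter_mem_natChannels]
    exact hex.choose_spec.choose_spec
  · simp at h

/-- Here the assumption on minima enters: wherever a demand can be met, the routine has an answer.
-/
theorem minPower_isSome (hI : I.HasMinima) {b : Block} (hb : b.IsValid M N) {i v : Fin M} {p : ℝ}
    (hp : p ∈ I.admissible i (b.channels M N v)) :
    (I.minPower i (b.natChannels M v)).isSome := by
  obtain ⟨p₀, hp₀⟩ := hI b hb i v ⟨p, hp⟩
  unfold minPower
  rw [dif_pos]
  · rfl
  · exact ⟨i.2, p₀, by rw [Block.filter_mem_natChannels]; exact hp₀⟩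

/-- User `i` can have order `v` in the block `b`. -/
def Fits (b : Block) (i v : ℕ) : Prop := (I.minPower i (b.natChannels M v)).isSome

/-- The power of user `i` with order `v` in the block `b`. -/
noncomputable def cost (b : Block) (i v : ℕ) : ℝ := (I.minPower i (b.natChannels M v)).getD 0

theorem cost_nonneg {b : Block} {i v : ℕ} (hi : i < M) (hv : v < M) (h : I.Fits b i v) :
    0 ≤ I.cost b i v :=
  (I.isLeast_of_minPower_isSome (i := ⟨i, hi⟩) (v := ⟨v, hv⟩) h).1.1

/-- A feasible allocation is an assignment of no greater cost. -/
theorem exists_assignment (hM : 1 ≤ M) (hI : I.HasMinima) {a : Allocation M}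
    (ha : I.IsFeasible a) :
    ∃ ν : ℕ → ℕ, (∀ x < M, ν x < M) ∧ (∀ x < M, I.Fits a.block x (ν x)) ∧
      Set.InjOn ν {x | x < M} ∧
      a.block.c * ∑ x ∈ Finset.range M, I.cost a.block x (ν x) ≤ a.totalPower N := by
  let ν : ℕ → ℕ := fun x => if h : x < M then a.order ⟨x, h⟩ else 0
  have hν : ∀ i : Fin M, ν i = a.order i := fun i => by simp [ν]
  have hfit : ∀ i : Fin M, I.Fits a.block i (ν i) := fun i => by
    rw [hν]; exact I.minPower_isSome hI ha.1 (ha.2 i)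
  refine ⟨ν, fun x hx => ?_, fun x hx => hfit ⟨x, hx⟩, fun x hx y hy hxy => ?_, ?_⟩
  · rw [hν ⟨x, hx⟩]; exact (a.order ⟨x, hx⟩).2
  · rw [hν ⟨x, hx⟩, hν ⟨y, hy⟩] at hxy
    exact congrArg Fin.val (a.order.injective (Fin.ext hxy))
  · rw [a.totalPower_eq hM ha.1, Finset.sum_range]
    refine mul_le_mul_of_nonneg_left (Finset.sum_le_sum fun i _ => ?_) (Nat.cast_nonneg _)
    have h := hfit i
    rw [hν] at h ⊢
    exact (I.isLeast_of_minPower_isSome h).2 (ha.2 i)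

/-- An assignment is a feasible allocation. -/
theorem exists_allocation (hM : 1 ≤ M) {b : Block} (hb : b.IsValid M N) {μ : ℕ → ℕ}
    (hlt : ∀ x < M, μ x < M) (hfit : ∀ x < M, I.Fits b x (μ x)) (hinj : Set.InjOn μ {x | x < M}) :
    ∃ a : Allocation M, I.IsFeasible a ∧ a.block = b ∧ (∀ i : Fin M, (a.order i : ℕ) = μ i) ∧
      (∀ i : Fin M, a.power i = I.cost b i (μ i)) ∧
      a.totalPower N = b.c * ∑ x ∈ Finset.range M, I.cost b x (μ x) := by
  let f : Fin M → Fin M := fun i => ⟨μ i, hlt i i.2⟩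
  have hf : Function.Injective f := fun i j hij =>
    Fin.ext (hinj i.2 j.2 (congrArg Fin.val hij))
  let a : Allocation M :=
    ⟨b, Equiv.ofBijective f (Finite.injective_iff_bijective.1 hf), fun i => I.cost b i (μ i)⟩
  refine ⟨a, ⟨hb, fun i => ?_⟩, rfl, fun i => rfl, fun i => rfl, ?_⟩
  · exact (I.isLeast_of_minPower_isSome (b := b) (i := i) (v := f i) (hfit i i.2)).1
  · rw [a.totalPower_eq hM hb, Finset.sum_range]

end Instance

end IFDMA

/-! ## Correctness of the program -/

namespace RAM

open Code Assignment IFDMA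

variable {O : ℕ → Finset ℕ → Option ℝ} {M N : ℕ} {F : ℕ → ℕ → Prop} {W : ℕ → ℕ → ℝ} {σ τ : State}

/-- If the stored assignment is better than the recorded allocation, it is recorded. -/
theorem wp_accept (h : Table M F W σ) (hm : ∀ x < M, σ.matching M M x < M) :
    Wp O accept σ fun τ t =>
      (σ.nat aOut 0 ≠ 0 ∧
        σ.real xBest 0 ≤ σ.nat aC 0 * ∑ x ∈ Finset.range M, W x (σ.matching M M x) ∧
        τ.nat aOut = σ.nat aOut ∧ τ.nat aOrder = σ.nat aOrder ∧ τ.real xPower = σ.real xPower ∧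
        τ.real xBest = σ.real xBest ∨
      (σ.nat aOut 0 ≠ 0 →
        σ.nat aC 0 * ∑ x ∈ Finset.range M, W x (σ.matching M M x) ≤ σ.real xBest 0) ∧
        τ.nat aOut 0 = 1 ∧ τ.nat aOut 1 = σ.nat aC 0 ∧ τ.nat aOut 2 = σ.nat aS 0 ∧
        τ.nat aOut 3 = σ.nat aQ 0 ∧ (∀ x < M, τ.nat aOrder x = σ.matching M M x) ∧
        (∀ x < M, τ.real xPower x = W x (σ.matching M M x)) ∧
        τ.real xBest 0 = σ.nat aC 0 * ∑ x ∈ Finset.range M, W x (σ.matching M M x)) ∧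
      t ≤ M * 110 + σ.nat aC 0 * 50 + 150 := by
  rw [accept, wp_seq]
  refine (wp_sumUp h hm).agree.mono fun σ₁ t₁ ⟨⟨hs, ht₁⟩, ha₁⟩ => ?_
  rw [wp_seq]
  refine wp_total.agree.mono fun σ₂ t₂ ⟨⟨htot, ht₂⟩, ha₂⟩ => ?_
  have hT := (h.of_agree ha₁ (by decide) (by decide)).of_agree ha₂ (by decide) (by decide)
  have e0 : σ₁.nat aC = σ.nat aC := ha₁.nat _ (by decide)
  have e1 : σ₂.nat aC = σ.nat aC := (ha₂.nat _ (by decide)).trans e0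
  have e2 : σ₂.nat aS = σ.nat aS := (ha₂.nat _ (by decide)).trans (ha₁.nat _ (by decide))
  have e3 : σ₂.nat aQ = σ.nat aQ := (ha₂.nat _ (by decide)).trans (ha₁.nat _ (by decide))
  have e4 : σ₂.nat aMatch = σ.nat aMatch := (ha₂.nat _ (by decide)).trans (ha₁.nat _ (by decide))
  have e5 : σ₂.nat aOut = σ.nat aOut := (ha₂.nat _ (by decide)).trans (ha₁.nat _ (by decide))
  have e6 : σ₂.nat aOrder = σ.nat aOrder := (ha₂.nat _ (by decide)).trans (ha₁.nat _ (by decide))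
  have e7 : σ₂.real xPower = σ.real xPower :=
    (ha₂.real _ (by decide)).trans (ha₁.real _ (by decide))
  have e8 : σ₂.real xBest = σ.real xBest := (ha₂.real _ (by decide)).trans (ha₁.real _ (by decide))
  rw [e0] at htot ht₂
  rw [hs] at htot
  rw [wp_branch, wp_skip]
  simp only [Test.Holds, NatExp.eval, RealExp.eval, Test.cost, NatExp.cost, RealExp.cost, e5, e8,
    htot]
  refine ⟨fun hc => ⟨Or.inl ⟨by omega, hc.2, trivial, e6, e7, trivial⟩, by omega⟩, fun hc => ?_⟩
  have em : ∀ x, σ₂.matching M M x = σ.matching M M x := fun x => by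
    rw [State.matching, State.matching, e4]
  refine (wp_record hT fun x hx => by rw [em]; exact hm x hx).mono fun τ t ⟨hr, ht⟩ => ?_
  simp only [em, e1, e2, e3, htot] at hr
  refine ⟨Or.inr ⟨fun h0 => ?_, hr⟩, by omega⟩
  -- An allocation was recorded and the test still failed, so the new total is smaller; ties keep
  -- the recorded allocation.
  by_contra hlt
  exact hc ⟨by omega, (not_le.1 hlt).le⟩

/-- The recorded allocation is the best one for the blocks in `S`. -/
def BestIn (I : Instance M N) (S : Set Block) (σ : State) : Prop :=
  (∃ a : Allocation M, I.IsFeasible a ∧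
    (∀ a' : Allocation M, I.IsFeasible a' → a'.block ∈ S → a.totalPower N ≤ a'.totalPower N) ∧
    σ.Returns a N) ∨
  ((∀ a : Allocation M, I.IsFeasible a → a.block ∉ S) ∧ σ.ReportsInfeasible)

/-- Feasible allocations have valid blocks, so invalid blocks may be added freely. At loop exits
this turns bounded ranges of parameters into full slices and finally into `Set.univ`. -/
theorem BestIn.congr {I : Instance M N} {S S' : Set Block} (h : BestIn I S σ)
    (hS : ∀ b : Block, b.IsValid M N → b ∈ S' → b ∈ S)
    (h1 : τ.nat aOut = σ.nat aOut) (h2 : τ.nat aOrder = σ.nat aOrder)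
    (h3 : τ.real xPower = σ.real xPower) (h4 : τ.real xBest = σ.real xBest) : BestIn I S' τ := by
  unfold BestIn State.Returns State.ReportsInfeasible at *
  rw [h1, h2, h3, h4]
  rcases h with ⟨a, ha, hopt, hret⟩ | ⟨hno, hrep⟩
  · exact Or.inl ⟨a, ha, fun a' ha' hb => hopt a' ha' (hS _ ha'.1 hb), hret⟩
  · exact Or.inr ⟨fun a ha hb => hno a ha (hS _ ha.1 hb), hrep⟩

theorem BestIn.mono {I : Instance M N} {S S' : Set Block} (h : BestIn I S σ)
    (hS : ∀ b : Block, b.IsValid M N → b ∈ S' → b ∈ S) : BestIn I S' σ :=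
  h.congr hS rfl rfl rfl rfl

/-- The current block. -/
abbrev State.block (σ : State) : Block := ⟨σ.nat aC 0, σ.nat aS 0, σ.nat aQ 0⟩

/-- A tight perfect matching is optimal for the block by duality, and the absence of a perfect
matching excludes feasible allocations there. In the time, M⁴ pays for the assignment and M²c for
the matrix. -/
theorem wp_tryBlock {I : Instance M N} (hI : I.HasMinima) (hM : 1 ≤ M) (hin : σ.nat aIn 0 = M)
    {S : Set Block} (hS : BestIn I S σ) (hb : σ.block.IsValid M N) :
    Wp I.minPower tryBlock σ fun τ t => BestIn I (insert σ.block S) τ ∧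
      t ≤ 4000 * (M ^ 4 + M ^ 2 * σ.nat aC 0) := by
  have hc1 : 1 ≤ σ.nat aC 0 := hb.1
  have htime : ∀ t₁ t₂ t₃, t₁ ≤ M * (M * (60 * σ.nat aC 0 + 80) + 50) + 30 → t₂ ≤ 3000 * M ^ 4 →
      t₃ ≤ M * 110 + σ.nat aC 0 * 50 + 160 →
      t₁ + t₂ + t₃ ≤ 4000 * (M ^ 4 + M ^ 2 * σ.nat aC 0) := by
    intro t₁ t₂ t₃ h1 h2 h3
    have i1 : M ≤ M ^ 4 := Nat.le_self_pow (by norm_num) M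
    have i2 : M ^ 2 ≤ M ^ 4 := Nat.pow_le_pow_right hM (by norm_num)
    have i3 : σ.nat aC 0 ≤ M ^ 2 * σ.nat aC 0 := Nat.le_mul_of_pos_left _ (by positivity)
    ring_nf at h1 h2 h3 i3 ⊢
    omega
  rw [tryBlock, wp_seq]
  refine (wp_fill hin).agree.mono fun σ₁ t₁ ⟨⟨hT, ht₁⟩, ha₁⟩ => ?_
  change Table M (I.Fits σ.block) (I.cost σ.block) σ₁ at hT
  rw [wp_seq]
  refine (wp_assign hM hT fun i hi j hj => I.cost_nonneg hi hj).agree.mono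
    fun σ₂ t₂ ⟨⟨hres, ht₂⟩, ha₂⟩ => ?_
  have hT₂ := hT.of_agree ha₂ (by decide) (by decide)
  have e1 : σ₂.nat aC = σ.nat aC := (ha₂.nat _ (by decide)).trans (ha₁.nat _ (by decide))
  have e2 : σ₂.nat aS = σ.nat aS := (ha₂.nat _ (by decide)).trans (ha₁.nat _ (by decide))
  have e3 : σ₂.nat aQ = σ.nat aQ := (ha₂.nat _ (by decide)).trans (ha₁.nat _ (by decide))
  have e5 : σ₂.nat aOut = σ.nat aOut := (ha₂.nat _ (by decide)).trans (ha₁.nat _ (by decide))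
  have e6 : σ₂.nat aOrder = σ.nat aOrder := (ha₂.nat _ (by decide)).trans (ha₁.nat _ (by decide))
  have e7 : σ₂.real xPower = σ.real xPower :=
    (ha₂.real _ (by decide)).trans (ha₁.real _ (by decide))
  have e8 : σ₂.real xBest = σ.real xBest := (ha₂.real _ (by decide)).trans (ha₁.real _ (by decide))
  have hS₂ : BestIn I S σ₂ := hS.congr (fun _ _ h => h) e5 e6 e7 e8
  rw [wp_branch]
  rcases hres with ⟨hf, hmat⟩ | ⟨hf, hno⟩
  · refine ⟨fun _ => ?_, fun hh => absurd (by simp [hf]) hh⟩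
    refine (wp_accept hT₂ hmat.matching.lt).mono fun τ t ⟨hr, ht⟩ => ⟨?_, ?_⟩
    · rw [e1, e2, e3] at hr
      obtain ⟨a, ha, hab, hao, hap, hat⟩ := I.exists_allocation hM hb hmat.matching.lt
        hmat.matching.edge hmat.matching.inj
      have hopt : ∀ a' : Allocation M, I.IsFeasible a' → a'.block = σ.block →
          a.totalPower N ≤ a'.totalPower N := by
        intro a' ha' hb'
        obtain ⟨ν, h1, h2, h3, h4⟩ := I.exists_assignment hM hI ha'
        rw [hb'] at h2 h4
        rw [hat]
        exact le_trans (mul_le_mul_of_nonneg_left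
          (hmat.matching.sum_le hmat.dual h1 h2 h3) (Nat.cast_nonneg _)) h4
      rw [← hat] at hr
      rcases hr with ⟨h0, hle, r1, r2, r3, r4⟩ | ⟨hle, r1, r2, r3, r4, r5, r6, r7⟩
      · rcases hS₂ with ⟨a₀, hfe, ho, hret⟩ | ⟨-, hrep⟩
        · left
          refine ⟨a₀, hfe, fun a' ha' hb' => ?_, ?_⟩
          · rcases hb' with hb' | hb'
            · rw [hret.2.2.2.2.2.2] at hle
              exact hle.trans (hopt a' ha' hb')
            · exact ho a' ha' hb'
          · unfold State.Returns at hret ⊢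
            rwa [r1, r2, r3, r4]
        · exact absurd hrep h0
      · left
        refine ⟨a, ha, fun a' ha' hb' => ?_, r1, by rw [hab, r2], by rw [hab, r3], by rw [hab, r4],
          fun i => by rw [hao, r5 i i.2], fun i => by rw [hap, r6 i i.2], r7⟩
        rcases hb' with hb' | hb'
        · exact hopt a' ha' hb'
        · rcases hS₂ with ⟨a₀, hfe, ho, hret⟩ | ⟨hno, -⟩
          · have := hle (by rw [hret.1]; exact one_ne_zero)
            rw [hret.2.2.2.2.2.2] at this
            exact this.trans (ho a' ha' hb')
          · exact absurd hb' (hno a' ha')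
    · rw [e1] at ht
      simp only [Test.cost, NatExp.cost]
      have := htime t₁ t₂ (t + 8) ht₁ ht₂ (by omega)
      omega
  · refine ⟨fun hh => absurd hh (by simp [hf]), fun _ => ?_⟩
    rw [wp_skip]
    refine ⟨?_, ?_⟩
    · have hnone : ∀ a : Allocation M, I.IsFeasible a → a.block ≠ σ.block := by
        intro a ha hab
        obtain ⟨ν, h1, h2, h3, -⟩ := I.exists_assignment hM hI ha
        rw [hab] at h2
        exact hno ν h1 h2 h3
      rcases hS₂ with ⟨a₀, hfe, ho, hret⟩ | ⟨hno', hrep⟩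
      · exact Or.inl ⟨a₀, hfe, fun a' ha' hb' =>
          ho a' ha' (hb'.resolve_left (hnone a' ha')), hret⟩
      · exact Or.inr ⟨fun a ha hb' => hno' a ha (hb'.resolve_left (hnone a ha)), hrep⟩
    · simp only [Test.cost, NatExp.cost]
      have := htime t₁ t₂ 8 ht₁ ht₂ (by omega)
      omega

/-- The length is at least `M ≥ 1`, so at most `N` offsets fit. -/
theorem wp_tryOffsets {I : Instance M N} (hI : I.HasMinima) (hM : 1 ≤ M)
    (hin : σ.nat aIn 0 = M) (hN : σ.nat aIn 1 = N) (hc : 1 ≤ σ.nat aC 0)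
    (hs : σ.nat aC 0 = 1 → σ.nat aS 0 = 0)
    (hL : σ.nat aLen 0 = (σ.nat aC 0 - 1) * (M + σ.nat aS 0) + M) (hLN : σ.nat aLen 0 ≤ N)
    {S : Set Block} (hS : BestIn I S σ) :
    Wp I.minPower tryOffsets σ fun τ t =>
      BestIn I (S ∪ {b | b.c = σ.nat aC 0 ∧ b.s = σ.nat aS 0}) τ ∧
      t ≤ 4100 * N * (M ^ 4 + M ^ 2 * σ.nat aC 0) := by
  rw [tryOffsets, wp_seq, wp_setNat]
  refine (wp_loop_variant (fun σ' =>
      BestIn I (S ∪ {b | b.c = σ.nat aC 0 ∧ b.s = σ.nat aS 0 ∧ b.q < σ'.nat aQ 0}) σ')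
    (fun σ' => N + 1 - (σ'.nat aQ 0 + σ.nat aLen 0))
    (4000 * (M ^ 4 + M ^ 2 * σ.nat aC 0) + 7) ?_ ?_).mono ?_
  · exact hS.congr (by simp) (by simp) (by simp) rfl rfl
  · intro σ' ha hInv hb
    have e0 : σ'.nat aIn = σ.nat aIn := by simp [ha.nat aIn (by decide)]
    have e1 : σ'.nat aC = σ.nat aC := by simp [ha.nat aC (by decide)]
    have e2 : σ'.nat aS = σ.nat aS := by simp [ha.nat aS (by decide)]
    have e3 : σ'.nat aLen = σ.nat aLen := by simp [ha.nat aLen (by decide)]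
    simp only [Test.Holds, NatExp.eval, e0, e3, hN] at hb
    have hv : σ'.block.IsValid M N := by
      rw [Block.isValid_iff hM]
      simp only [Block.length, e1, e2, ← hL]
      exact ⟨hc, hs, hb⟩
    rw [wp_seq]
    refine (wp_tryBlock hI hM (by rw [e0, hin]) hInv hv).agree.mono fun τ t ⟨⟨hbest, ht⟩, ha'⟩ => ?_
    have e4 : τ.nat aQ = σ'.nat aQ := ha'.nat _ (by decide)
    rw [e1] at ht
    simp only [wp_setNat]
    simp only [NatExp.eval, NatExp.cost, write_self, if_true, e4]
    refine ⟨hbest.congr ?_ (by simp) (by simp) rfl rfl, by omega, by omega⟩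
    rintro ⟨c, s, q⟩ - (hbS | ⟨h1, h2, h3⟩)
    · exact Or.inr (Or.inl hbS)
    · rcases Nat.lt_succ_iff_lt_or_eq.1 h3 with hlt | heq
      · exact Or.inr (Or.inr ⟨h1, h2, hlt⟩)
      · left
        simp only at h1 h2 heq
        simp only [State.block, e1, e2, h1, h2, heq]
  · rintro τ t ⟨hInv, hb, ht, ha⟩
    have e0 : τ.nat aIn = σ.nat aIn := by simp [ha.nat aIn (by decide)]
    have e3 : τ.nat aLen = σ.nat aLen := by simp [ha.nat aLen (by decide)]
    simp only [Test.Holds, NatExp.eval, e0, e3, hN, not_le] at hb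
    refine ⟨hInv.mono ?_, ?_⟩
    · rintro b hbv (hbS | ⟨h1, h2⟩)
      · exact Or.inl hbS
      · refine Or.inr ⟨h1, h2, ?_⟩
        have := ((Block.isValid_iff hM).1 hbv).2.2
        rw [Block.length, h1, h2, ← hL] at this
        omega
    · simp only [Test.cost, NatExp.cost, NatExp.eval, write_self, if_true, zero_add] at ht ⊢
      set X := M ^ 4 + M ^ 2 * σ.nat aC 0
      have hX : 1 ≤ X := le_add_right (Nat.one_le_pow _ _ hM)
      have hm : (N + 1 - σ.nat aLen 0) ≤ N := by omega
      have h1 : (N + 1 - σ.nat aLen 0) * (4000 * X + 7 + (1 + 1 + (1 + 1) + 1 + (1 + 1) + 1) + 1) ≤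
        N * (4000 * X + 7 + (1 + 1 + (1 + 1) + 1 + (1 + 1) + 1) + 1) := Nat.mul_le_mul_right _ hm
      have h2 : N ≤ N * X := Nat.le_mul_of_pos_right _ hX
      have h3 : 1 ≤ N := by omega
      have h4 : 4100 * N * X = 4100 * (N * X) := by ring
      have h5 : N * (4000 * X + 7 + (1 + 1 + (1 + 1) + 1 + (1 + 1) + 1) + 1) = 4000 * (N * X) + 16 * N := by
        ring
      omega

theorem wp_tryGaps {I : Instance M N} (hI : I.HasMinima) (hM : 1 ≤ M)
    (hin : σ.nat aIn 0 = M) (hN : σ.nat aIn 1 = N) (hc : 1 ≤ σ.nat aC 0)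
    (hbase : σ.nat aBase 0 = σ.nat aC 0 * M) (hbN : σ.nat aBase 0 ≤ N)
    {S : Set Block} (hS : BestIn I S σ) :
    Wp I.minPower tryGaps σ fun τ t =>
      BestIn I (S ∪ {b | b.c = σ.nat aC 0}) τ ∧ t ≤ 30000 * (N ^ 2 * M ^ 4) := by
  set c := σ.nat aC 0 with hcdef
  simp only [tryGaps, wp_seq, wp_setNat]
  have hNX : 1 ≤ N * (M ^ 4 + M ^ 2 * c) :=
    Nat.mul_pos (by nlinarith) (le_add_right (Nat.one_le_pow _ _ hM))
  refine (wp_loop_variant (fun σ' =>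
      BestIn I (S ∪ {b | b.c = c ∧ b.s < σ'.nat aS 0}) σ' ∧
      ((c = 1 ∧ (σ'.nat aS 0 = 0 ∧ σ'.nat aLen 0 = M ∨ σ'.nat aS 0 = 1 ∧ σ'.nat aLen 0 = N + 1)) ∨
        2 ≤ c ∧ σ'.nat aLen 0 = c * M + σ'.nat aS 0 * (c - 1)))
    -- For `c = 1` the quotient is `0` by the convention for division by zero, which matches the
    -- single pass made in that case.
    (fun σ' => N / (c - 1) + 1 - σ'.nat aS 0)
    (4200 * N * (M ^ 4 + M ^ 2 * c)) ?_ ?_).mono ?_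
  · refine ⟨hS.congr (by simp) (by simp) (by simp) rfl rfl, ?_⟩
    simp only [NatExp.eval, write_self, write_of_ne, ne_eq, Nat.reduceEqDiff, not_false_iff, if_true,
      hbase]
    rcases hc.eq_or_lt with h | h
    · exact Or.inl ⟨h.symm, Or.inl ⟨trivial, by rw [← h, one_mul]⟩⟩
    · exact Or.inr ⟨h, by simp⟩
  · rintro σ' ha ⟨hInv, hL⟩ hb
    have e0 : σ'.nat aIn = σ.nat aIn := by simp [ha.nat aIn (by decide)]
    have e1 : σ'.nat aC = σ.nat aC := by simp [ha.nat aC (by decide)]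
    have e1' : σ'.nat aC 0 = c := by rw [e1]
    simp only [Test.Holds, NatExp.eval, e0, hN] at hb
    have hs : c = 1 → σ'.nat aS 0 = 0 := by omega
    have hL' : σ'.nat aLen 0 = (c - 1) * (M + σ'.nat aS 0) + M := by
      rcases hL with ⟨h1, h2 | h2⟩ | ⟨h1, h2⟩
      · rw [h1, h2.2]; simp
      · omega
      · obtain ⟨d, hd⟩ := Nat.exists_eq_add_of_le' hc
        rw [h2, hd, Nat.add_sub_cancel]; ring
    have hsle : σ'.nat aS 0 ≤ N / (c - 1) := by
      rcases hL with ⟨h1, h2⟩ | ⟨h1, h2⟩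
      · rw [hs h1]; exact Nat.zero_le _
      · rw [Nat.le_div_iff_mul_le (by omega)]; omega
    rw [tryGap, wp_seq]
    refine (wp_tryOffsets hI hM (by rw [e0, hin]) (by rw [e0, hN]) (by rwa [e1'])
      (by rwa [e1']) (by rwa [e1']) hb hInv).agree.mono fun σ₂ t₂ ⟨⟨hbest, ht₂⟩, ha₂⟩ => ?_
    have f0 : σ₂.nat aIn = σ.nat aIn := (ha₂.nat _ (by decide)).trans e0
    have f1 : σ₂.nat aC 0 = c := by rw [ha₂.nat _ (by decide), e1]
    have f2 : σ₂.nat aS = σ'.nat aS := ha₂.nat _ (by decide)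
    have f3 : σ₂.nat aLen = σ'.nat aLen := ha₂.nat _ (by decide)
    rw [e1'] at hbest ht₂
    have hset : ∀ b : Block, b.IsValid M N → b ∈ S ∪ {b | b.c = c ∧ b.s < σ'.nat aS 0 + 1} →
        b ∈ S ∪ {b | b.c = c ∧ b.s < σ'.nat aS 0} ∪ {b | b.c = c ∧ b.s = σ'.nat aS 0} := by
      rintro b - (hbS | ⟨h1, h2⟩)
      · exact Or.inl (Or.inl hbS)
      · rcases Nat.lt_succ_iff_lt_or_eq.1 h2 with h3 | h3
        exacts [Or.inl (Or.inr ⟨h1, h3⟩), Or.inr ⟨h1, h3⟩]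
    have h4 : 4200 * N * (M ^ 4 + M ^ 2 * c) = 4200 * (N * (M ^ 4 + M ^ 2 * c)) := by ring
    have h5 : 4100 * N * (M ^ 4 + M ^ 2 * c) = 4100 * (N * (M ^ 4 + M ^ 2 * c)) := by ring
    simp only [wp_seq, wp_branch, wp_setNat]
    simp only [Test.Holds, NatExp.eval, NatExp.cost, Test.cost, write_self, write_of_ne, ne_eq,
      Nat.reduceEqDiff, not_false_iff, if_true, f0, f1, f2, f3, hN]
    refine ⟨fun hc1 => ⟨⟨?_, ?_⟩, ?_, ?_⟩, fun hc1 => ⟨⟨?_, ?_⟩, ?_, ?_⟩⟩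
    · exact hbest.congr hset (by simp) (by simp) rfl rfl
    · exact Or.inl ⟨by omega, Or.inr ⟨by rw [hs (by omega)], trivial⟩⟩
    · omega
    · omega
    · exact hbest.congr hset (by simp) (by simp) rfl rfl
    · refine Or.inr ⟨by omega, ?_⟩
      rcases hL with ⟨h1, -⟩ | ⟨h1, h2⟩
      · omega
      · rw [h2]; ring
    · omega
    · omega
  · rintro τ t ⟨⟨hInv, hL⟩, hb, ht, ha⟩
    have e0 : τ.nat aIn = σ.nat aIn := by simp [ha.nat aIn (by decide)]
    simp only [Test.Holds, NatExp.eval, e0, hN, not_le] at hb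
    refine ⟨hInv.mono ?_, ?_⟩
    · rintro b hbv (hbS | h1)
      · exact Or.inl hbS
      · have h1 : b.c = c := h1
        refine Or.inr ⟨h1, ?_⟩
        obtain ⟨-, hb1, hb2⟩ := (Block.isValid_iff hM).1 hbv
        rw [Block.length, h1] at hb2
        rw [h1] at hb1
        rcases hL with ⟨h2, ⟨h3, h4⟩ | ⟨h3, h4⟩⟩ | ⟨h2, h3⟩
        · rw [h2] at hbase; omega
        · rw [hb1 h2, h3]; exact one_pos
        -- The length grows with `s`, so a block with at least the current gap is too long as well.
        · by_contra hle
          have : (c - 1) * (M + τ.nat aS 0) ≤ (c - 1) * (M + b.s) :=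
            Nat.mul_le_mul_left _ (by omega)
          obtain ⟨d, hd⟩ := Nat.exists_eq_add_of_le' hc
          rw [hd, Nat.add_sub_cancel] at this hb2 h3
          have h6 : (d + 1) * M + τ.nat aS 0 * d = d * (M + τ.nat aS 0) + M := by ring
          omega
    · simp only [Test.cost, NatExp.cost, NatExp.eval, write_self, write_of_ne, ne_eq,
        Nat.reduceEqDiff, not_false_iff, if_true, Nat.sub_zero] at ht ⊢
      have hcN : c ≤ N := by nlinarith
      have hm1 : N / (c - 1) + 1 ≤ 2 * N := by
        rcases hc.eq_or_lt with h | h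
        · rw [← h]; simp; omega
        · have := Nat.div_le_self N (c - 1); omega
      -- Large blocks have few gaps: this keeps the term M²c at O(N) per offset, up to powers of
      -- `M`, after summing over the gaps.
      have hm2 : (N / (c - 1) + 1) * c ≤ 3 * N := by
        rcases hc.eq_or_lt with h | h
        · rw [← h]; simp; omega
        · have h7 := Nat.div_mul_le_self N (c - 1)
          obtain ⟨d, hd⟩ := Nat.exists_eq_add_of_le' hc
          rw [hd, Nat.add_sub_cancel] at h7 ⊢
          have h8 : N / d ≤ N / d * d := Nat.le_mul_of_pos_right _ (by omega)
          have h9 : (N / d + 1) * (d + 1) = N / d * d + N / d + d + 1 := by ring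
          omega
      set m := N / (c - 1) + 1
      have i1 : m * (4200 * N * (M ^ 4 + M ^ 2 * c) + (1 + 1 + (1 + 1) + 1) + 1) =
          4200 * N * (m * M ^ 4 + (m * c) * M ^ 2) + 6 * m := by ring
      have i2 : m * M ^ 4 ≤ 2 * N * M ^ 4 := Nat.mul_le_mul_right _ hm1
      have i3 : (m * c) * M ^ 2 ≤ 3 * N * M ^ 4 :=
        Nat.mul_le_mul hm2 (Nat.pow_le_pow_right hM (by norm_num))
      have i4 : 4200 * N * (m * M ^ 4 + (m * c) * M ^ 2) ≤ 4200 * N * (2 * N * M ^ 4 + 3 * N * M ^ 4) :=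
        Nat.mul_le_mul_left _ (Nat.add_le_add i2 i3)
      have i5 : 4200 * N * (2 * N * M ^ 4 + 3 * N * M ^ 4) = 21000 * (N ^ 2 * M ^ 4) := by ring
      have i6 : N ≤ N ^ 2 * M ^ 4 :=
        (Nat.le_self_pow (by norm_num) N).trans (Nat.le_mul_of_pos_right _ (by positivity))
      omega

theorem wp_minPower {I : Instance M N} (hI : I.HasMinima) (hM : 1 ≤ M) (hMN : M ≤ N) :
    Wp I.minPower Code.minPower (State.init M N) fun τ t =>
      BestIn I Set.univ τ ∧ t ≤ 40000 * (M ^ 3 * N ^ 3) := by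
  simp only [Code.minPower, wp_seq, wp_setNat]
  have hin : (State.init M N).nat aIn 0 = M := by simp [State.init]
  have hN : (State.init M N).nat aIn 1 = N := by simp [State.init]
  have hN0 : 0 < N := by omega
  have hNM : 1 ≤ N ^ 2 * M ^ 4 := Nat.mul_pos (by positivity) (by positivity)
  refine (wp_loop_variant (fun σ' => BestIn I {b | b.c < σ'.nat aC 0} σ' ∧
      1 ≤ σ'.nat aC 0 ∧ σ'.nat aBase 0 = σ'.nat aC 0 * M)
    (fun σ' => N / M + 1 - σ'.nat aC 0) (30100 * (N ^ 2 * M ^ 4)) ?_ ?_).mono ?_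
  · refine ⟨Or.inr ⟨fun a ha hb => ?_, ?_⟩, ?_, ?_⟩
    · have h1 : a.block.c < 1 := by simpa using hb
      have := ha.1.1
      omega
    · simp [State.ReportsInfeasible, State.init]
    · simp
    · simp [hin]
  · rintro σ' ha ⟨hInv, hc, hbase⟩ hb
    have e0 : σ'.nat aIn = (State.init M N).nat aIn := by simp [ha.nat aIn (by decide)]
    simp only [Test.Holds, NatExp.eval, e0, hN] at hb
    have hcle : σ'.nat aC 0 ≤ N / M := by rwa [Nat.le_div_iff_mul_le hM, ← hbase]
    rw [tryCount, wp_seq]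
    refine (wp_tryGaps hI hM (by rw [e0, hin]) (by rw [e0, hN]) hc hbase hb hInv).agree.mono
      fun τ t ⟨⟨hbest, ht⟩, ha'⟩ => ?_
    have f0 : τ.nat aIn 0 = M := by rw [ha'.nat _ (by decide), e0, hin]
    have f1 : τ.nat aC = σ'.nat aC := ha'.nat _ (by decide)
    have f2 : τ.nat aBase = σ'.nat aBase := ha'.nat _ (by decide)
    simp only [wp_seq, wp_setNat]
    simp only [NatExp.eval, NatExp.cost, write_self, write_of_ne, ne_eq, Nat.reduceEqDiff,
      not_false_iff, if_true, f0, f1, f2, hbase]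
    refine ⟨⟨hbest.congr ?_ (by simp) (by simp) rfl rfl, by omega, by ring⟩, by omega, by omega⟩
    intro b _ hbc
    rcases Nat.lt_succ_iff_lt_or_eq.1 (show b.c < σ'.nat aC 0 + 1 from hbc) with h | h
    exacts [Or.inl h, Or.inr h]
  · rintro τ t ⟨⟨hInv, hc, hbase⟩, hb, ht, ha⟩
    have e0 : τ.nat aIn = (State.init M N).nat aIn := by simp [ha.nat aIn (by decide)]
    simp only [Test.Holds, NatExp.eval, e0, hN, not_le] at hb
    refine ⟨hInv.mono fun b hbv _ => ?_, ?_⟩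
    · have h1 : b.c * M ≤ N := (Nat.le_div_iff_mul_le hM).1 hbv.2.1
      rw [hbase] at hb
      exact Nat.lt_of_mul_lt_mul_right (h1.trans_lt hb)
    · simp only [Test.cost, NatExp.cost, NatExp.eval, write_self, write_of_ne, ne_eq,
        Nat.reduceEqDiff, not_false_iff, if_true, Nat.add_sub_cancel] at ht ⊢
      have i1 : N / M * (30100 * (N ^ 2 * M ^ 4) + (1 + 1 + (1 + 1) + 1) + 1) ≤
          N / M * (30106 * (N ^ 2 * M ^ 4)) := Nat.mul_le_mul_left _ (by omega)
      -- One factor `M` is split off and absorbed by `N / M * M ≤ N`, so that M⁴ becomes M³.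
      have i2 : N / M * (30106 * (N ^ 2 * M ^ 4)) = 30106 * ((N / M * M) * (N ^ 2 * M ^ 3)) := by ring
      have i3 : (N / M * M) * (N ^ 2 * M ^ 3) ≤ N * (N ^ 2 * M ^ 3) :=
        Nat.mul_le_mul_right _ (Nat.div_mul_le_self N M)
      have i4 : N * (N ^ 2 * M ^ 3) = M ^ 3 * N ^ 3 := by ring
      have i5 : 1 ≤ M ^ 3 * N ^ 3 := Nat.mul_pos (by positivity) (by positivity)
      omega

end RAM

theorem theorem1 :
    (∀ M N : ℕ, 1 ≤ M → M ≤ N →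
      {b : IFDMA.Block | b.IsValid M N}.encard ≤ (((N + 1) + (N + 1) ^ 3 : ℕ) : ℕ∞)) ∧
    ∃ (P : RAM.Program) (C : ℕ), ∀ (M N : ℕ), 1 ≤ M → M ≤ N →
      ∀ I : IFDMA.Instance M N, I.HasMinima →
        ∃ (σ : RAM.State) (t : ℕ),
          RAM.Exec I.minPower P (RAM.State.init M N) σ t ∧
          t ≤ C * (M ^ 3 * N ^ 3) ∧
          ((∃ a : IFDMA.Allocation M, I.IsOptimal a ∧ σ.Returns a N) ∨
            ((∀ a : IFDMA.Allocation M, ¬ I.IsFeasible a) ∧ σ.ReportsInfeasible)) := by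
  refine ⟨fun M N hM _ => IFDMA.Block.encard_isValid_le hM, RAM.Code.minPower, 40000,
    fun M N hM hMN I hI => ?_⟩
  obtain ⟨σ, t, hex, hbest, ht⟩ := RAM.wp_minPower hI hM hMN
  refine ⟨σ, t, hex, ht, ?_⟩
  rcases hbest with ⟨a, ha, hopt, hret⟩ | ⟨hno, hrep⟩
  · exact Or.inl ⟨a, ⟨ha, fun a' ha' => hopt a' ha' trivial⟩, hret⟩
  · exact Or.inr ⟨fun a ha => hno a ha trivial, hrep⟩
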